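/- A circle in the Euclidean plane has positive radius. For $\theta\in[0,\pi/2]$, two distinct circles $C_1, C_2$ \emph{intersect at angle $\theta$} if they have a common point and, at each of their common points, the smaller angle between the tangent line to $C_1$ and the tangent line to $C_2$ equals $\theta$ (so angle $0$ means that the circles are tangent). The \emph{$\theta$-graph} of a collection $\mathcal{C}$ of circles is the graph with vertex set $\mathcal{C}$ in which two distinct circles are adjacent if and only if they intersect at angle $\theta$. Theorem. For every $\theta\in[0,\pi/2]$ and all non-negative integers $g$ and $k$, there is a finite collection $\mathcal{C}$ of circles in the plane whose $\theta$-graph has girth at least $g$ and chromatic number at least $k$. Here the girth is the minimum length of a cycle (infinite if there is no cycle). -/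

import Mathlib

noncomputable section

/-- The Euclidean plane. -/
abbrev Plane : Type := EuclideanSpace ℝ (Fin 2)

/-- A circle in the plane: a center together with a positive radius. -/
abbrev PlaneCircle : Type := {S : EuclideanGeometry.Sphere Plane // 0 < S.radius}

/-- The tangent line to the circle `C` at its point `p`: the line through `p` that is orthogonal
to the radius at `p`. -/
def PlaneCircle.tangentLine (C : PlaneCircle) (p : Plane) : AffineSubspace ℝ Plane :=
  C.1.orthRadius p

/-- The (smaller) angle between two lines. For two lines, the angles between a direction vector of
the first and a direction vector of the second are some `α` and `π - α`; the smaller is taken. -/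
def lineAngle (l₁ l₂ : AffineSubspace ℝ Plane) : ℝ :=
  sInf {α : ℝ | ∃ u ∈ l₁.direction, ∃ v ∈ l₂.direction,
    u ≠ 0 ∧ v ≠ 0 ∧ α = InnerProductGeometry.angle u v}

theorem lineAngle_comm (l₁ l₂ : AffineSubspace ℝ Plane) : lineAngle l₁ l₂ = lineAngle l₂ l₁ := by
  unfold lineAngle
  congr 1
  ext α
  constructor
  · rintro ⟨u, hu, v, hv, hu0, hv0, rfl⟩
    exact ⟨v, hv, u, hu, hv0, hu0, InnerProductGeometry.angle_comm u v⟩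
  · rintro ⟨u, hu, v, hv, hu0, hv0, rfl⟩
    exact ⟨v, hv, u, hu, hv0, hu0, InnerProductGeometry.angle_comm u v⟩

/-- Two circles intersect at angle `θ`: they have a common point, and at each common point
the (smaller) angle between their tangent lines is `θ`. -/
def IntersectAtAngle (θ : ℝ) (C₁ C₂ : PlaneCircle) : Prop :=
  (∃ p, p ∈ C₁.1 ∧ p ∈ C₂.1) ∧
    ∀ p, p ∈ C₁.1 → p ∈ C₂.1 → lineAngle (C₁.tangentLine p) (C₂.tangentLine p) = θ

theorem IntersectAtAngle.symm {θ : ℝ} {C₁ C₂ : PlaneCircle} (h : IntersectAtAngle θ C₁ C₂) :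
    IntersectAtAngle θ C₂ C₁ := by
  obtain ⟨⟨p, hp₁, hp₂⟩, h⟩ := h
  exact ⟨⟨p, hp₂, hp₁⟩, fun q hq₂ hq₁ => (lineAngle_comm _ _).trans (h q hq₁ hq₂)⟩

/-- The `θ`-graph of a collection of circles: its vertices are the circles of the collection, and
two distinct circles are adjacent when they intersect at angle `θ`. -/
def thetaGraph (θ : ℝ) (𝒞 : Set PlaneCircle) : SimpleGraph 𝒞 where
  Adj C₁ C₂ := C₁ ≠ C₂ ∧ IntersectAtAngle θ C₁.1 C₂.1
  symm := ⟨fun _ _ h => ⟨h.1.symm, h.2.symm⟩⟩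
  loopless := ⟨fun _ h => h.1 rfl⟩

end

/-!
A Tutte-type construction of graphs of large girth and chromatic number is carried out inside the
class of graphs that are realizable by circles.

Given a graph `G` on `V` and a system `E` of combinatorial lines in a cube `ι → V`, the graph
`amalgam G E` consists of the independent set of points of the cube and one copy of `G` for every
line `l ∈ E`, whose vertex `v` is joined to the point `l v` of the line. If every colouring of the
cube with `n + 1` colours has a monochromatic line in `E` and `G` is not `n`-colourable, then the
amalgam is not `(n + 1)`-colourable. If neither `G` nor the hypergraph `E` has short cycles, the same
holds for the amalgam. Line systems without short cycles are provided by the sparse Hales–Jewett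
theorem `sparseHalesJewett`, which is proved from the Hales–Jewett theorem by the partite
construction of Nešetřil and Rödl. Absence of short cycles is throughout expressed by the existence
of leaves in small sets, see `LocallyTreelike` and `SimpleGraph.IsLocallyForest`.

It remains to realize amalgams geometrically. A generic projection
(`exists_generic_projection`) maps the cube injectively to the real line such that every
combinatorial line becomes a homothetic copy of one and the same set `pos`. For an angle `θ > 0`, a
circle with centre `(x, y)` and radius `r` meets the vertical line with abscissa
`x + r * cos θ` at angle `θ`. With `pos v = x v + r v * cos θ`, the points of the cube become vertical
lines and the copies of `G` homothetic copies of a realization of `G`, which can be moved apart in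
the vertical direction; an inversion then turns the lines into circles. Vertical lines are pairwise
tangent at infinity, so tangency needs a different argument: circles touching from the inside
correspond to points of Minkowski space at lightlike distance, the points of the cube are placed
on a spacelike line, and the copies of `G` are separated by boosts that fix this line. In both cases
general position excludes adjacencies other than those of the amalgam.
-/

/-! ### Locally tree-like families of sets -/

/-- A family of sets `e`, viewed as the edges of a hypergraph, is locally tree-like up to size `p`
if any two or more of its members, at most `p` in number, contain a leaf, i.e. a member meeting the
union of the others in at most one point; moreover the leaf can be chosen different from a
prescribed member `i₀`. This says that the hypergraph has no (Berge) cycle of length at most `p`. -/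
def LocallyTreelike {I X : Type*} (p : ℕ) (e : I → Set X) : Prop :=
  ∀ T : Finset I, T.card ≤ p → ∀ i₀ ∈ T, T ≠ {i₀} →
    ∃ i ∈ T, i ≠ i₀ ∧ {x ∈ e i | ∃ j ∈ T, j ≠ i ∧ x ∈ e j}.Subsingleton

namespace LocallyTreelike

variable {I J X : Type*} {p q : ℕ} {e : I → Set X}

theorem mono (h : LocallyTreelike q e) (hpq : p ≤ q) : LocallyTreelike p e :=
  fun T hT => h T (hT.trans hpq)

theorem comp_injective (h : LocallyTreelike p e) {f : J → I} (hf : f.Injective) :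
    LocallyTreelike p (fun j => e (f j)) := by
  classical
  intro T hT i₀ hi₀ hne
  obtain ⟨i, hi, hii₀, hs⟩ := h (T.image f) (Finset.card_image_le.trans hT) (f i₀)
    (Finset.mem_image_of_mem f hi₀) (by
      intro h
      rw [← Finset.image_singleton] at h
      exact hne (Finset.image_injective hf h))
  obtain ⟨j, hj, rfl⟩ := Finset.mem_image.1 hi
  refine ⟨j, hj, fun h => hii₀ (h ▸ rfl), hs.anti ?_⟩
  rintro x ⟨hx, j', hj', hne', hx'⟩
  exact ⟨hx, f j', Finset.mem_image_of_mem f hj', fun h => hne' (hf h), hx'⟩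

theorem of_subsingleton (h : ∀ i, (e i).Subsingleton) : LocallyTreelike p e := by
  intro T _ i₀ hi₀ hne
  obtain ⟨i, hi, hii₀⟩ : ∃ i ∈ T, i ≠ i₀ := by
    by_contra! hcon
    exact hne (Finset.eq_singleton_iff_unique_mem.2 ⟨hi₀, hcon⟩)
  exact ⟨i, hi, hii₀, (h i).anti fun x hx => hx.1⟩

theorem of_pairwise_disjoint (h : ∀ i j x, x ∈ e i → x ∈ e j → i = j) : LocallyTreelike p e := by
  intro T _ i₀ hi₀ hne
  obtain ⟨i, hi, hii₀⟩ : ∃ i ∈ T, i ≠ i₀ := by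
    by_contra! hcon
    exact hne (Finset.eq_singleton_iff_unique_mem.2 ⟨hi₀, hcon⟩)
  refine ⟨i, hi, hii₀, ?_⟩
  rintro x ⟨hx, j, _, hj, hxj⟩
  exact absurd (h _ _ _ hxj hx) hj

theorem of_le_one (e : I → Set X) : LocallyTreelike 1 e := by
  intro T hT i₀ hi₀ hne
  exact absurd (Finset.eq_singleton_iff_unique_mem.2
    ⟨hi₀, fun x hx => Finset.card_le_one.1 hT x hx i₀ hi₀⟩) hne

/-- The prescribed member in the definition may be traded for a prescribed point: a forest with at
least two edges has two leaves, and a point outside the attachment vertices lies on only one of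
them. -/
theorem exists_leaf_of_point (h : LocallyTreelike p e) {T : Finset I} (hT : T.card ≤ p)
    (hne : T.Nonempty) {Z : Set X} (hZ : Z.Subsingleton) :
    ∃ i ∈ T, {x ∈ e i | x ∈ Z ∨ ∃ j ∈ T, j ≠ i ∧ x ∈ e j}.Subsingleton := by
  obtain ⟨i₁, hi₁⟩ := hne
  by_cases hT1 : T = {i₁}
  · refine ⟨i₁, hi₁, hZ.anti ?_⟩
    rintro x ⟨hx, hx' | ⟨j, hj, hji, _⟩⟩
    · exact hx'
    · rw [hT1] at hj
      exact absurd (Finset.mem_singleton.1 hj) hji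
  obtain ⟨i, hi, hii₁, hs⟩ := h T hT i₁ hi₁ hT1
  by_cases hz : ∃ z ∈ Z, z ∈ e i ∧ ∀ j ∈ T, j ≠ i → z ∉ e j
  · obtain ⟨z, hzZ, -, hzj⟩ := hz
    obtain ⟨i', hi', hii', hs'⟩ := h T hT i hi (by
      rintro rfl
      exact hii₁ (Finset.mem_singleton.1 hi₁).symm)
    refine ⟨i', hi', hs'.anti ?_⟩
    rintro x ⟨hx, hx' | hx'⟩
    · obtain rfl := hZ hx' hzZ
      exact absurd hx (hzj i' hi' hii')
    · exact ⟨hx, hx'⟩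
  · push Not at hz
    refine ⟨i, hi, hs.anti ?_⟩
    rintro x ⟨hx, hx' | hx'⟩
    · exact ⟨hx, hz x hx' hx⟩
    · exact ⟨hx, hx'⟩

end LocallyTreelike

/-! ### A sparse Hales–Jewett theorem -/

namespace Combinatorics.Line

variable {α ι μ : Type*} {P : (ι → α) → Prop}

/-- A line `h` in the cube `μ → X`, where the alphabet `X` is itself a set of points of the cube
`ι → α`, extends to an embedding of the whole cube `ι → α` into `μ × ι → α`: the active coordinates
of `h` carry the given point, the others are fixed. -/
def cubeMap (h : Line (Subtype P) μ) (z : ι → α) : μ × ι → α :=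
  fun s => (h.idxFun s.1).elim (z s.2) (fun x => x.1 s.2)

/-- The line in `μ × ι → α` that is the image of the line `l` under `h.cubeMap`. -/
def nest (h : Line (Subtype P) μ) (l : Line α ι) : Line α (μ × ι) where
  idxFun s := (h.idxFun s.1).elim (l.idxFun s.2) (fun x => some (x.1 s.2))
  proper := by
    obtain ⟨s, hs⟩ := h.proper
    obtain ⟨t, ht⟩ := l.proper
    exact ⟨(s, t), by simp [hs, ht]⟩

theorem nest_apply (h : Line (Subtype P) μ) (l : Line α ι) (a : α) :
    h.nest l a = h.cubeMap (l a) := by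
  funext s
  cases hs : h.idxFun s.1 <;> simp [nest, cubeMap, hs]

theorem cubeMap_subtype (h : Line (Subtype P) μ) (x : Subtype P) :
    h.cubeMap x.1 = fun s => (h x s.1).1 s.2 := by
  funext s
  cases hs : h.idxFun s.1 <;> simp [cubeMap, hs]

theorem cubeMap_active {h : Line (Subtype P) μ} {s : μ} (hs : h.idxFun s = none) (z : ι → α) :
    (fun t => h.cubeMap z (s, t)) = z := by
  funext t
  simp [cubeMap, hs]

theorem cubeMap_fixed {h : Line (Subtype P) μ} {s : μ} {x : Subtype P} (hs : h.idxFun s = some x)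
    (z : ι → α) : (fun t => h.cubeMap z (s, t)) = x.1 := by
  funext t
  simp [cubeMap, hs]

theorem cubeMap_injective (h : Line (Subtype P) μ) : h.cubeMap.Injective := by
  intro z z' hz
  obtain ⟨s, hs⟩ := h.proper
  rw [← cubeMap_active hs z, ← cubeMap_active hs z', hz]

theorem apply_injective (l : Line α ι) : Function.Injective l := by
  intro a b hab
  obtain ⟨s, hs⟩ := l.proper
  simpa [hs] using congrFun hab s

theorem active_of_cubeMap_eq {h h' : Line (Subtype P) μ} {z z' : ι → α}
    (hz : h.cubeMap z = h'.cubeMap z') (hP : ¬ P z) {s : μ} (hs : h.idxFun s = none) :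
    h'.idxFun s = none := by
  have h1 := cubeMap_active hs z
  rw [hz] at h1
  cases hs' : h'.idxFun s with
  | none => rfl
  | some x =>
    rw [cubeMap_fixed hs'] at h1
    exact absurd (h1 ▸ x.2) hP

/-- Two copies of the cube attached along different lines meet only in points of the alphabet
`Subtype P` along which they are glued. -/
theorem of_cubeMap_eq {h h' : Line (Subtype P) μ} {z z' : ι → α}
    (hz : h.cubeMap z = h'.cubeMap z') (hne : h ≠ h') : P z := by
  by_contra hP
  obtain ⟨s₀, hs₀⟩ := h.proper
  have hz' : z = z' := by
    rw [← cubeMap_active hs₀ z, ← cubeMap_active (active_of_cubeMap_eq hz hP hs₀) z', hz]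
  subst hz'
  apply hne
  ext1
  funext s
  cases hs : h.idxFun s with
  | none => rw [active_of_cubeMap_eq hz hP hs]
  | some x =>
    cases hs' : h'.idxFun s with
    | none =>
      rw [active_of_cubeMap_eq hz.symm hP hs'] at hs
      exact hs.symm
    | some x' =>
      have := cubeMap_fixed hs z
      rw [hz, cubeMap_fixed hs'] at this
      rw [Subtype.ext this]

theorem apply_eq_of_cubeMap_eq {h h' : Line (Subtype P) μ} {x x' : Subtype P}
    (hz : h.cubeMap x.1 = h'.cubeMap x'.1) : h x = h' x' := by
  rw [cubeMap_subtype, cubeMap_subtype] at hz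
  funext s
  apply Subtype.ext
  funext t
  exact congrFun hz (s, t)

end Combinatorics.Line

open Combinatorics

/-- If at most `2 * p` pairs are grouped by their first component and all groups but one have at
least two members, there are at most `p` groups. -/
theorem card_image_fst_le {I J : Type*} [DecidableEq I] {T : Finset (I × J)} {p : ℕ}
    (hT : T.card ≤ 2 * p) {h₀ : I}
    (hbig : ∀ h ∈ T.image Prod.fst, h ≠ h₀ → 2 ≤ (T.filter (fun t => t.1 = h)).card)
    (hh₀ : h₀ ∈ T.image Prod.fst) : (T.image Prod.fst).card ≤ p := by
  have h1 := Finset.card_eq_sum_card_image Prod.fst T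
  have h2 : ∑ h ∈ T.image Prod.fst, (if h = h₀ then 1 else 2) ≤ T.card := by
    rw [h1]
    refine Finset.sum_le_sum fun h hh => ?_
    split_ifs with h'
    · obtain ⟨t, ht, rfl⟩ := Finset.mem_image.1 hh
      exact Finset.card_pos.2 ⟨t, by simp [ht]⟩
    · exact hbig h hh h'
  have h3 : ∑ h ∈ T.image Prod.fst, (if h = h₀ then 1 else 2) + 1 = 2 * (T.image Prod.fst).card := by
    rw [← Finset.add_sum_erase _ _ hh₀, Finset.sum_congr rfl (g := fun _ => 2)]
    · have := Finset.card_pos.2 ⟨h₀, hh₀⟩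
      simp [Finset.card_erase_of_mem hh₀]
      omega
    · intro h hh
      simp [Finset.ne_of_mem_erase hh]
  omega

/-- Amalgamation doubles the girth. Glue copies of the line system `e`, one for each line
`h ∈ E`, along the points satisfying `P`; each line of `e` has at most one such point. If the
gluing pattern `E` is locally tree-like up to size `p` and `e` is so up to size `2 * p`, so is the
result: a copy that contributes a single line to a set `T` provides a leaf, and if every copy
(with one exception) contributes at least two lines, there are at most `p` copies. -/
theorem LocallyTreelike.nest {α ι μ I : Type} {P : (ι → α) → Prop} {p : ℕ}
    {E : Set (Line (Subtype P) μ)} (hE : LocallyTreelike p (fun h : E => Set.range h.1))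
    {e : I → Line α ι} (he : LocallyTreelike (2 * p) (fun i => Set.range (e i)))
    (heP : ∀ i a b, P (e i a) → P (e i b) → a = b) :
    LocallyTreelike (2 * p) (fun t : E × I => Set.range (t.1.1.nest (e t.2))) := by
  classical
  intro T hT t₀ ht₀ hne
  -- a common point of lines from different copies lies in the gluing set
  have key : ∀ (h h' : E) (i i' : I) (a b : α), h ≠ h' →
      h.1.nest (e i) a = h'.1.nest (e i') b → P (e i a) := by
    intro h h' i i' a b hh hab
    rw [Line.nest_apply, Line.nest_apply] at hab
    exact Line.of_cubeMap_eq hab (fun h => hh (Subtype.ext h))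
  by_cases hA : ∃ h ∈ T.image Prod.fst, h ≠ t₀.1 ∧ (T.filter (fun t => t.1 = h)).card < 2
  · obtain ⟨h, hh, hh₀, hcard⟩ := hA
    obtain ⟨t, ht, rfl⟩ := Finset.mem_image.1 hh
    refine ⟨t, ht, fun h => hh₀ (h ▸ rfl), ?_⟩
    have hP : ∀ a j, j ∈ T → j ≠ t → t.1.1.nest (e t.2) a ∈ Set.range (j.1.1.nest (e j.2)) →
        P (e t.2 a) := by
      rintro a j hj hjt ⟨b, hb⟩
      refine key t.1 j.1 t.2 j.2 a b (fun h => hjt ?_) hb.symm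
      exact Finset.card_le_one.1 (Nat.lt_succ_iff.1 hcard) j (by simp [hj, h]) t (by simp [ht])
    rintro _ ⟨⟨a, rfl⟩, j, hj, hjt, hx⟩ _ ⟨⟨b, rfl⟩, j', hj', hjt', hx'⟩
    rw [heP _ _ _ (hP a j hj hjt hx) (hP b j' hj' hjt' hx')]
  push Not at hA
  have hmem₀ : t₀.1 ∈ T.image Prod.fst := Finset.mem_image_of_mem _ ht₀
  have hcard := card_image_fst_le hT hA hmem₀
  have himg : ∀ h, ((T.filter (fun t => t.1 = h)).image Prod.snd).card ≤ 2 * p := fun h =>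
    (Finset.card_image_le.trans (Finset.card_filter_le _ _)).trans hT
  have hmem : ∀ h i, i ∈ (T.filter (fun t => t.1 = h)).image Prod.snd ↔ (h, i) ∈ T := by
    intro h i
    simp
  by_cases hB : T.image Prod.fst = {t₀.1}
  · have hfst : ∀ t ∈ T, t.1 = t₀.1 := fun t ht =>
      Finset.mem_singleton.1 (hB ▸ Finset.mem_image_of_mem Prod.fst ht)
    obtain ⟨i, hi, hi₀, hs⟩ := he _ (himg t₀.1) t₀.2 ((hmem _ _).2 ht₀) (by
      intro hsing
      refine hne (Finset.eq_singleton_iff_unique_mem.2 ⟨ht₀, fun t ht => ?_⟩)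
      refine Prod.ext (hfst t ht) (Finset.mem_singleton.1 (hsing ▸ (hmem _ _).2 ?_))
      rw [← hfst t ht]
      exact ht)
    refine ⟨(t₀.1, i), (hmem _ _).1 hi, fun h => hi₀ (congrArg Prod.snd h), ?_⟩
    have hback : ∀ a j, j ∈ T → j ≠ (t₀.1, i) →
        t₀.1.1.nest (e i) a ∈ Set.range (j.1.1.nest (e j.2)) →
        e i a ∈ {x ∈ Set.range (e i) | ∃ j ∈ (T.filter (fun t => t.1 = t₀.1)).image Prod.snd,
          j ≠ i ∧ x ∈ Set.range (e j)} := by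
      rintro a ⟨j1, j2⟩ hj hji ⟨b, hb⟩
      obtain rfl : j1 = t₀.1 := hfst _ hj
      refine ⟨⟨a, rfl⟩, j2, (hmem _ _).2 hj, fun h => hji (h ▸ rfl), b, ?_⟩
      rw [Line.nest_apply, Line.nest_apply] at hb
      exact Line.cubeMap_injective _ hb
    rintro _ ⟨⟨a, rfl⟩, j, hj, hjt, hx⟩ _ ⟨⟨b, rfl⟩, j', hj', hjt', hx'⟩
    have := hs (hback a j hj hjt hx) (hback b j' hj' hjt' hx')
    simp only [Line.nest_apply, this]
  · obtain ⟨h, hh, hh₀, hs⟩ := hE _ hcard t₀.1 hmem₀ hB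
    -- the points of the original cube at which the leaf copy is attached to the other copies
    let Z : Set (ι → α) := {z | ∃ hz : P z, h.1 ⟨z, hz⟩ ∈ {x ∈ Set.range h.1 |
      ∃ j ∈ T.image Prod.fst, j ≠ h ∧ x ∈ Set.range j.1}}
    have hZ : Z.Subsingleton := by
      rintro z ⟨hz, hz1⟩ z' ⟨hz', hz1'⟩
      exact congrArg Subtype.val (Line.apply_injective h.1 (hs hz1 hz1'))
    obtain ⟨t, ht, hth⟩ := Finset.mem_image.1 hh
    obtain ⟨i, hi, hsi⟩ := he.exists_leaf_of_point (himg h)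
      ⟨t.2, (hmem _ _).2 (hth ▸ ht)⟩ hZ
    refine ⟨(h, i), (hmem _ _).1 hi, fun h => hh₀ (congrArg Prod.fst h), ?_⟩
    have hback : ∀ a j, j ∈ T → j ≠ (h, i) →
        h.1.nest (e i) a ∈ Set.range (j.1.1.nest (e j.2)) →
        e i a ∈ {x ∈ Set.range (e i) | x ∈ Z ∨
          ∃ j ∈ (T.filter (fun t => t.1 = h)).image Prod.snd, j ≠ i ∧ x ∈ Set.range (e j)} := by
      rintro a ⟨j1, j2⟩ hj hji ⟨b, hb⟩
      by_cases hj1 : j1 = h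
      · subst hj1
        refine ⟨⟨a, rfl⟩, Or.inr ⟨j2, (hmem _ _).2 hj, fun h => hji (h ▸ rfl), b, ?_⟩⟩
        rw [Line.nest_apply, Line.nest_apply] at hb
        exact Line.cubeMap_injective _ hb
      · have hPa := key h j1 i j2 a b (fun h => hj1 h.symm) hb.symm
        have hPb := key j1 h j2 i b a hj1 hb
        refine ⟨⟨a, rfl⟩, Or.inl ⟨hPa, ⟨_, rfl⟩, j1, Finset.mem_image_of_mem Prod.fst hj, hj1,
          ⟨e j2 b, hPb⟩, ?_⟩⟩
        simp only [Line.nest_apply] at hb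
        exact Line.apply_eq_of_cubeMap_eq hb
    rintro _ ⟨⟨a, rfl⟩, j, hj, hjt, hx⟩ _ ⟨⟨b, rfl⟩, j', hj', hjt', hx'⟩
    have := hsi (hback a j hj hjt hx) (hback b j' hj' hjt' hx')
    simp only [Line.nest_apply, this]

/-- The Hales–Jewett property of the alphabet `α` for `κ` colours holds with line systems that are
locally tree-like up to size `p`. -/
def SparseHalesJewett (p : ℕ) (α κ : Type) : Prop :=
  ∃ (ι : Type) (_ : Fintype ι) (E : Set (Line α ι)),
    (∀ C : (ι → α) → κ, ∃ l ∈ E, l.IsMono C) ∧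
      LocallyTreelike p (fun l : E => Set.range l.1)

/-- An intermediate stage of the partite construction. The points of the cube `ι → α` are sorted
by `π` into parts indexed by the points of the cube `Q = (ι₀ → α)`, and the lines `e` are mapped
bijectively onto lines of `Q`. Whatever the colouring, every line of `Q` has a lift `e i` on which
the colour of a point depends only on its part, as far as the parts in `D` are concerned. -/
def PartiteSystem (p : ℕ) (α κ ι₀ : Type) (D : Finset (ι₀ → α)) : Prop :=
  ∃ (ι : Type) (_ : Fintype ι) (I : Type) (e : I → Line α ι) (π : (ι → α) → (ι₀ → α)),
    (∀ i a b, π (e i a) = π (e i b) → a = b) ∧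
    LocallyTreelike p (fun i => Set.range (e i)) ∧
    ∀ C : (ι → α) → κ, ∃ χ : (ι₀ → α) → κ, ∀ L : Line α ι₀, ∃ i, (∀ a, π (e i a) = L a) ∧
      ∀ a, L a ∈ D → C (e i a) = χ (L a)

theorem partiteSystem_empty (p : ℕ) (α κ ι₀ : Type) [Finite α] [Fintype ι₀] [Nontrivial α]
    [Nonempty κ] : PartiteSystem p α κ ι₀ ∅ := by
  classical
  obtain ⟨a₀, a₁, ha⟩ := exists_pair_ne α
  have : Finite (Line α ι₀) := Finite.of_injective Line.idxFun (fun l m h => Line.ext h)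
  cases nonempty_fintype (Line α ι₀)
  -- one active coordinate, and one further coordinate for each line, to keep the lifts disjoint
  let e : Line α ι₀ → Line α (Option (Line α ι₀)) := fun L =>
    ⟨fun s => s.elim none (fun L' => some (if L' = L then a₁ else a₀)), none, rfl⟩
  let π : (Option (Line α ι₀) → α) → (ι₀ → α) := fun z =>
    if h : ∃ L, z (some L) = a₁ then h.choose (z none) else fun _ => a₀
  have hπ : ∀ L a, π (e L a) = L a := by
    intro L a
    have h : ∃ L', e L a (some L') = a₁ := ⟨L, by simp [e]⟩
    have huniq : ∀ L', e L a (some L') = a₁ → L' = L := by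
      intro L' hL'
      by_contra hne
      simp [e, hne, ha] at hL'
    have h2 : h.choose = L := huniq _ h.choose_spec
    have h3 : e L a none = a := by simp [e]
    simp only [π, dif_pos h, h2, h3]
  refine ⟨Option (Line α ι₀), inferInstance, Line α ι₀, e, π, ?_, ?_, ?_⟩
  · intro L a b hab
    rw [hπ, hπ] at hab
    exact Line.apply_injective L hab
  · apply LocallyTreelike.of_pairwise_disjoint
    rintro L L' _ ⟨a, rfl⟩ ⟨b, hb⟩
    by_contra hne
    have := congrFun hb (some L)
    simp [e, hne, ha] at this
  · intro C
    exact ⟨fun _ => Classical.arbitrary κ, fun L => ⟨L, hπ L, by simp⟩⟩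

/-- The amalgamation step: one more part `q` becomes monochromatic after gluing copies along the
lines of a sparse Hales–Jewett system whose alphabet is the set of points in that part. -/
theorem PartiteSystem.insert {p : ℕ} {α κ ι₀ : Type} {D : Finset (ι₀ → α)} [DecidableEq (ι₀ → α)]
    [Finite α] (hp : ∀ β : Type, Finite β → SparseHalesJewett p β κ)
    (hD : PartiteSystem (2 * p) α κ ι₀ D) (q : ι₀ → α) :
    PartiteSystem (2 * p) α κ ι₀ (insert q D) := by
  obtain ⟨ι, _, I, e, π, hπe, hsp, hmono⟩ := hD
  let P : (ι → α) → Prop := fun z => π z = q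
  obtain ⟨μ, _, E, hE, hEsp⟩ := hp (Subtype P) inferInstance
  classical
  let π' : (μ × ι → α) → (ι₀ → α) := fun z =>
    if h : ∃ s, π (fun t => z (s, t)) ≠ q then π (fun t => z (h.choose, t)) else q
  have hπ' : ∀ (h : Line (Subtype P) μ) (z : ι → α), π' (h.cubeMap z) = π z := by
    intro h z
    by_cases hs : ∃ s, π (fun t => h.cubeMap z (s, t)) ≠ q
    · have hs' := hs.choose_spec
      simp only [π', dif_pos hs]
      cases hc : h.idxFun hs.choose with
      | none => rw [Line.cubeMap_active hc]
      | some x =>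
        rw [Line.cubeMap_fixed hc] at hs'
        exact absurd x.2 hs'
    · simp only [π', dif_neg hs]
      push Not at hs
      obtain ⟨s, hs'⟩ := h.proper
      rw [← hs s, Line.cubeMap_active hs']
  refine ⟨μ × ι, inferInstance, E × I, fun t => t.1.1.nest (e t.2), π', ?_, ?_, ?_⟩
  · rintro ⟨h, i⟩ a b hab
    simp only [Line.nest_apply, hπ'] at hab
    exact hπe i a b hab
  · exact hEsp.nest hsp (fun i a b ha hb => hπe i a b (ha.trans hb.symm))
  · intro C
    obtain ⟨h, hhE, c, hc⟩ := hE (fun f => C (fun s => (f s.1).1 s.2))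
    obtain ⟨χ, hχ⟩ := hmono (fun z => C (h.cubeMap z))
    refine ⟨Function.update χ q c, fun L => ?_⟩
    obtain ⟨i, hi, hiD⟩ := hχ L
    refine ⟨(⟨h, hhE⟩, i), fun a => by rw [Line.nest_apply, hπ', hi], fun a ha => ?_⟩
    simp only [Line.nest_apply]
    by_cases hq : L a = q
    · rw [hq, Function.update_self]
      have := hc ⟨e i a, (hi a).trans hq⟩
      rw [← this]
      exact congrArg C (Line.cubeMap_subtype h ⟨e i a, (hi a).trans hq⟩)
    · rw [Function.update_of_ne hq]
      exact hiD a (Finset.mem_of_mem_insert_of_ne ha hq)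

theorem sparseHalesJewett_double {p : ℕ} {κ : Type} [Finite κ]
    (hp : ∀ β : Type, Finite β → SparseHalesJewett p β κ) (α : Type) [Finite α] :
    SparseHalesJewett (2 * p) α κ := by
  classical
  obtain ⟨ι₀, _, hHJ⟩ := Line.exists_mono_in_high_dimension α κ
  rcases subsingleton_or_nontrivial α with hα | hα
  · refine ⟨ι₀, inferInstance, Set.univ, fun C => ?_, LocallyTreelike.of_subsingleton fun l => ?_⟩
    · obtain ⟨l, hl⟩ := hHJ C
      exact ⟨l, trivial, hl⟩
    · rintro _ ⟨a, rfl⟩ _ ⟨b, rfl⟩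
      rw [Subsingleton.elim a b]
  rcases isEmpty_or_nonempty κ with hκ | hκ
  · exact ⟨ι₀, inferInstance, ∅, fun C => isEmptyElim (C fun _ => Classical.arbitrary α),
      LocallyTreelike.of_pairwise_disjoint fun i => i.2.elim⟩
  have hfin : PartiteSystem (2 * p) α κ ι₀ (Set.finite_univ (α := ι₀ → α)).toFinset := by
    induction (Set.finite_univ (α := ι₀ → α)).toFinset using Finset.induction with
    | empty => exact partiteSystem_empty _ _ _ _
    | insert q D _ ih => exact ih.insert hp q
  obtain ⟨ι, hι, I, e, π, hπe, hsp, hmono⟩ := hfin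
  refine ⟨ι, hι, Set.range e, fun C => ?_, ?_⟩
  · obtain ⟨χ, hχ⟩ := hmono C
    obtain ⟨L, c, hc⟩ := hHJ χ
    obtain ⟨i, hi, hiL⟩ := hχ L
    exact ⟨e i, ⟨i, rfl⟩, c, fun a => by rw [hiL a (by simp), hc]⟩
  · have hspec : ∀ l : Set.range e, e l.2.choose = l.1 := fun l => l.2.choose_spec
    have := hsp.comp_injective (f := fun l : Set.range e => l.2.choose) (by
      intro l l' hll
      apply Subtype.ext
      rw [← hspec l, ← hspec l']
      exact congrArg e hll)
    simpa only [hspec] using this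

/-- **Sparse Hales–Jewett theorem.** There are systems of combinatorial lines of arbitrarily large
girth such that every colouring has a monochromatic line in the system. -/
theorem sparseHalesJewett (p : ℕ) (α κ : Type) [Finite α] [Finite κ] : SparseHalesJewett p α κ := by
  suffices h : ∀ n : ℕ, ∀ β : Type, Finite β → SparseHalesJewett (2 ^ n) β κ by
    obtain ⟨ι, hι, E, hE, hsp⟩ := h p α inferInstance
    exact ⟨ι, hι, E, hE, hsp.mono Nat.lt_two_pow_self.le⟩
  intro n
  induction n with
  | zero =>
    intro β _
    obtain ⟨ι, hι, hHJ⟩ := Line.exists_mono_in_high_dimension β κ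
    refine ⟨ι, hι, Set.univ, fun C => ?_, LocallyTreelike.of_le_one _⟩
    obtain ⟨l, hl⟩ := hHJ C
    exact ⟨l, trivial, hl⟩
  | succ n ih =>
    intro β _
    rw [pow_succ']
    exact sparseHalesJewett_double ih β

/-! ### Graphs without short cycles and the amalgam of a graph along a line system -/

/-- Every set of at least two and at most `g` vertices of `G` induces a subgraph with a vertex of
degree at most one, which can be chosen different from a prescribed vertex. This says that `G` has
no cycle of length at most `g`. -/
def SimpleGraph.IsLocallyForest {V : Type*} (g : ℕ) (G : SimpleGraph V) : Prop :=
  ∀ W : Finset V, W.card ≤ g → ∀ w₀ ∈ W, W ≠ {w₀} →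
    ∃ w ∈ W, w ≠ w₀ ∧ {u | u ∈ W ∧ G.Adj w u}.Subsingleton

theorem SimpleGraph.IsLocallyForest.le_egirth {V : Type*} {g : ℕ} {G : SimpleGraph V}
    (h : G.IsLocallyForest g) : (g : ℕ∞) ≤ G.egirth := by
  classical
  rw [SimpleGraph.le_egirth]
  intro a w hw
  by_contra! hlt
  have hlen : w.length < g := by exact_mod_cast hlt
  have hcard : w.support.toFinset.card ≤ g := by
    have h1 : w.support.toFinset = w.support.tail.toFinset := by
      ext u
      rw [List.mem_toFinset, List.mem_toFinset]
      refine ⟨fun hu => ?_, List.mem_of_mem_tail⟩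
      rcases SimpleGraph.Walk.mem_support_iff w |>.1 hu with rfl | hu
      · exact SimpleGraph.Walk.end_mem_tail_support hw.not_nil
      · exact hu
    rw [h1]
    refine (List.toFinset_card_le _).trans ?_
    simp
    omega
  have htwo : ∀ v ∈ w.support, ∃ x ∈ w.support, ∃ y ∈ w.support, x ≠ y ∧ G.Adj v x ∧ G.Adj v y := by
    intro v hv
    obtain ⟨x, y, hxy, hs⟩ := Set.ncard_eq_two.1 (hw.ncard_neighborSet_toSubgraph_eq_two hv)
    have hx : w.toSubgraph.Adj v x := by
      rw [← SimpleGraph.Subgraph.mem_neighborSet, hs]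
      simp
    have hy : w.toSubgraph.Adj v y := by
      rw [← SimpleGraph.Subgraph.mem_neighborSet, hs]
      simp
    exact ⟨x, by simpa using hx.snd_mem, y, by simpa using hy.snd_mem, hxy, hx.adj_sub, hy.adj_sub⟩
  obtain ⟨x, hx, -, -, -, hax, -⟩ := htwo a w.start_mem_support
  obtain ⟨v, hv, -, hs⟩ := h w.support.toFinset hcard a (by simp) (by
    intro hsing
    have : x ∈ ({a} : Finset V) := hsing ▸ List.mem_toFinset.2 hx
    exact hax.ne (Finset.mem_singleton.1 this).symm)
  obtain ⟨y, hy, z, hz, hyz, hay, haz⟩ := htwo v (List.mem_toFinset.1 hv)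
  exact hyz (hs ⟨List.mem_toFinset.2 hy, hay⟩ ⟨List.mem_toFinset.2 hz, haz⟩)

/-- The amalgam of a graph `G` on `V` along a set `E` of lines of the cube `ι → V`: the points of
the cube, pairwise non-adjacent, together with one copy of `G` for every line `l ∈ E`, where the
vertex `v` of that copy is also joined to the point `l v`. -/
def amalgam {V ι : Type} (G : SimpleGraph V) (E : Set (Line V ι)) :
    SimpleGraph ((ι → V) ⊕ (E × V)) where
  Adj
    | .inl _, .inl _ => False
    | .inl z, .inr (l, v) => z = l.1 v
    | .inr (l, v), .inl z => z = l.1 v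
    | .inr (l, v), .inr (m, u) => l = m ∧ G.Adj v u
  symm := ⟨by
    rintro (z | ⟨l, v⟩) (z' | ⟨m, u⟩) h
    · exact h
    · exact h
    · exact h
    · exact ⟨h.1.symm, h.2.symm⟩⟩
  loopless := ⟨by
    rintro (z | ⟨l, v⟩) h
    · exact h
    · exact G.loopless.irrefl v h.2⟩

section
variable {V ι : Type} {G : SimpleGraph V} {E : Set (Line V ι)}

@[simp] theorem amalgam_adj_inl_inl (z z' : ι → V) :
    (amalgam G E).Adj (.inl z) (.inl z') ↔ False := Iff.rfl

@[simp] theorem amalgam_adj_inl_inr (z : ι → V) (l : E) (v : V) :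
    (amalgam G E).Adj (.inl z) (.inr (l, v)) ↔ z = l.1 v := Iff.rfl

@[simp] theorem amalgam_adj_inr_inl (z : ι → V) (l : E) (v : V) :
    (amalgam G E).Adj (.inr (l, v)) (.inl z) ↔ z = l.1 v := Iff.rfl

@[simp] theorem amalgam_adj_inr_inr (l m : E) (v u : V) :
    (amalgam G E).Adj (.inr (l, v)) (.inr (m, u)) ↔ l = m ∧ G.Adj v u := Iff.rfl

/-- If all `n + 1`-colourings of the cube have a monochromatic line in `E`, the copy of `G` attached
to that line has to avoid its colour, so the amalgam has larger chromatic number than `G`. -/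
theorem not_colorable_amalgam {n : ℕ} (hG : ¬ G.Colorable n)
    (hE : ∀ C : (ι → V) → Fin (n + 1), ∃ l ∈ E, l.IsMono C) :
    ¬ (amalgam G E).Colorable (n + 1) := by
  rintro ⟨C⟩
  obtain ⟨l, hl, c, hc⟩ := hE (fun z => C (.inl z))
  have hne : ∀ v, C (.inr (⟨l, hl⟩, v)) ≠ c := by
    intro v h
    have hadj : (amalgam G E).Adj (.inl (l v)) (.inr (⟨l, hl⟩, v)) := rfl
    exact C.valid hadj ((hc v).trans h.symm)
  apply hG
  let K : G.Coloring {d : Fin (n + 1) // d ≠ c} :=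
    SimpleGraph.Coloring.mk (fun v => ⟨C (.inr (⟨l, hl⟩, v)), hne v⟩) (by
      intro v u hvu h
      have hadj : (amalgam G E).Adj (.inr (⟨l, hl⟩, v)) (.inr (⟨l, hl⟩, u)) := ⟨rfl, hvu⟩
      exact C.valid hadj (congrArg Subtype.val h))
  have := K.colorable
  simpa [Fintype.card_subtype_compl] using this

theorem isLocallyForest_amalgam {g : ℕ} (hG : G.IsLocallyForest g)
    (hE : LocallyTreelike g (fun l : E => Set.range l.1)) :
    (amalgam G E).IsLocallyForest g := by
  classical
  intro W hW w₀ hw₀ hne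
  obtain ⟨T, hTmem⟩ : ∃ T : Finset E, T = W.toRight.image Prod.fst := ⟨_, rfl⟩
  have hT : ∀ l, l ∈ T ↔ ∃ v, Sum.inr (l, v) ∈ W := by
    intro l
    simp [hTmem]
  have hTcard : T.card ≤ g := by
    rw [hTmem]
    exact Finset.card_image_le.trans (Finset.card_toRight_le.trans hW)
  -- the part of `W` in the copy of `G` attached to the line `l`
  let R : E → Finset V := fun l => (W.toRight.filter (fun t => t.1 = l)).image Prod.snd
  have hR : ∀ l v, v ∈ R l ↔ Sum.inr (l, v) ∈ W := by
    intro l v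
    simp [R]
  have hRcard : ∀ l, (R l).card ≤ g := fun l =>
    Finset.card_image_le.trans ((Finset.card_filter_le _ _).trans
      (Finset.card_toRight_le.trans hW))
  rcases T.eq_empty_or_nonempty with hT0 | hTne
  · obtain ⟨w, hw, hww₀⟩ : ∃ w ∈ W, w ≠ w₀ := by
      by_contra! hcon
      exact hne (Finset.eq_singleton_iff_unique_mem.2 ⟨hw₀, hcon⟩)
    have hinl : ∀ w ∈ W, ∃ z, w = .inl z := by
      rintro (z | ⟨l, v⟩) hw
      · exact ⟨z, rfl⟩
      · have := (hT l).2 ⟨v, hw⟩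
        simp [hT0] at this
    refine ⟨w, hw, hww₀, ?_⟩
    rintro u ⟨hu, hadj⟩
    obtain ⟨z, rfl⟩ := hinl w hw
    obtain ⟨z', rfl⟩ := hinl u hu
    exact hadj.elim
  by_cases hspecial : ∃ m v₀, T = {m} ∧ w₀ = .inr (m, v₀)
  · obtain ⟨m, v₀, hTm, rfl⟩ := hspecial
    have hm : ∀ l v, Sum.inr (l, v) ∈ W → l = m := fun l v h =>
      Finset.mem_singleton.1 (hTm ▸ (hT l).2 ⟨v, h⟩)
    by_cases hy : ∃ y, Sum.inl y ∈ W
    · obtain ⟨y, hy⟩ := hy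
      refine ⟨.inl y, hy, by simp, ?_⟩
      rintro (z | ⟨l, v⟩) ⟨h1, h2⟩ (z' | ⟨l', v'⟩) ⟨h1', h2'⟩
      · exact h2.elim
      · exact h2.elim
      · exact h2'.elim
      · obtain rfl := hm l v h1
        obtain rfl := hm l' v' h1'
        rw [amalgam_adj_inl_inr] at h2 h2'
        rw [Line.apply_injective _ (h2.symm.trans h2')]
    · push Not at hy
      obtain ⟨v, hv, hvv₀, hs⟩ := hG (R m) (hRcard m) v₀ ((hR _ _).2 hw₀) (by
        intro hsing
        refine hne (Finset.eq_singleton_iff_unique_mem.2 ⟨hw₀, ?_⟩)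
        rintro (z | ⟨l, v⟩) hw
        · exact absurd hw (hy z)
        · obtain rfl := hm l v hw
          have : v ∈ ({v₀} : Finset V) := hsing ▸ (hR _ _).2 hw
          rw [Finset.mem_singleton.1 this])
      refine ⟨.inr (m, v), (hR _ _).1 hv, by simpa using hvv₀, ?_⟩
      rintro (z | ⟨l, u⟩) ⟨h1, h2⟩ (z' | ⟨l', u'⟩) ⟨h1', h2'⟩
      · exact absurd h1 (hy z)
      · exact absurd h1 (hy z)
      · exact absurd h1' (hy z')
      · obtain rfl := hm l u h1
        obtain rfl := hm l' u' h1'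
        rw [hs ⟨(hR _ _).2 h1, h2.2⟩ ⟨(hR _ _).2 h1', h2'.2⟩]
  -- a leaf of the hypergraph of lines, whose copy of `G` does not contain the prescribed vertex
  obtain ⟨m, hmT, hmw, hS⟩ : ∃ m ∈ T, (∀ v, w₀ ≠ .inr (m, v)) ∧
      {y | y ∈ Set.range m.1 ∧ (w₀ = .inl y ∨ ∃ j ∈ T, j ≠ m ∧ y ∈ Set.range j.1)}.Subsingleton := by
    rcases w₀ with y₀ | ⟨m₀, v₀⟩
    · obtain ⟨m, hm, hs⟩ := hE.exists_leaf_of_point hTcard hTne (Z := {y₀})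
        Set.subsingleton_singleton
      refine ⟨m, hm, by simp, hs.anti ?_⟩
      rintro y ⟨hy, h | h⟩
      · exact ⟨hy, Or.inl (Sum.inl_injective h).symm⟩
      · exact ⟨hy, Or.inr h⟩
    · obtain ⟨m, hm, hmm, hs⟩ := hE T hTcard m₀ ((hT _).2 ⟨v₀, hw₀⟩)
        (fun h => hspecial ⟨m₀, v₀, h, rfl⟩)
      refine ⟨m, hm, ?_, hs.anti ?_⟩
      · intro v h
        exact hmm (congrArg Prod.fst (Sum.inr_injective h)).symm
      · rintro y ⟨hy, h | h⟩
        · exact absurd h (by simp)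
        · exact ⟨hy, h⟩
  set S := {y | y ∈ Set.range m.1 ∧ (w₀ = .inl y ∨ ∃ j ∈ T, j ≠ m ∧ y ∈ Set.range j.1)} with hSdef
  obtain ⟨v₁, hv₁⟩ := (hT m).1 hmT
  by_cases hone : ∃ v₀, R m = {v₀} ∧ m.1 v₀ ∈ S
  · obtain ⟨v₀, hRm, -⟩ := hone
    have hv₀ : Sum.inr (m, v₀) ∈ W := (hR _ _).1 (by simp [hRm])
    refine ⟨.inr (m, v₀), hv₀, (hmw v₀).symm, ?_⟩
    have : ∀ u, u ∈ W → (amalgam G E).Adj (.inr (m, v₀)) u → u = .inl (m.1 v₀) := by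
      rintro (z | ⟨l, u⟩) hu hadj
      · rw [amalgam_adj_inr_inl] at hadj
        rw [hadj]
      · obtain ⟨rfl, hadj⟩ := hadj
        have : u ∈ ({v₀} : Finset V) := hRm ▸ (hR _ _).2 hu
        exact absurd (Finset.mem_singleton.1 this).symm hadj.ne
    rintro u ⟨hu, hadj⟩ u' ⟨hu', hadj'⟩
    rw [this u hu hadj, this u' hu' hadj']
  obtain ⟨v, hv, hvS, hvs⟩ : ∃ v ∈ R m, m.1 v ∉ S ∧ {u | u ∈ R m ∧ G.Adj v u}.Subsingleton := by
    by_cases h0 : ∃ v₀ ∈ R m, m.1 v₀ ∈ S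
    · obtain ⟨v₀, hv₀, hv₀S⟩ := h0
      obtain ⟨v, hv, hvv₀, hs⟩ := hG (R m) (hRcard m) v₀ hv₀ (fun h => hone ⟨v₀, h, hv₀S⟩)
      exact ⟨v, hv, fun h => hvv₀ (Line.apply_injective m.1 (hS h hv₀S)), hs⟩
    · push Not at h0
      have hv₁' := (hR _ _).2 hv₁
      by_cases h1 : R m = {v₁}
      · refine ⟨v₁, hv₁', h0 _ hv₁', ?_⟩
        rintro u ⟨hu, hadj⟩
        rw [h1] at hu
        exact absurd (Finset.mem_singleton.1 hu).symm hadj.ne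
      · obtain ⟨v, hv, -, hs⟩ := hG (R m) (hRcard m) v₁ hv₁' h1
        exact ⟨v, hv, h0 v hv, hs⟩
  by_cases hy : Sum.inl (m.1 v) ∈ W
  · refine ⟨.inl (m.1 v), hy, fun h => hvS ⟨⟨v, rfl⟩, Or.inl h.symm⟩, ?_⟩
    have : ∀ u, u ∈ W → (amalgam G E).Adj (.inl (m.1 v)) u → u = .inr (m, v) := by
      rintro (z | ⟨l, u⟩) hu hadj
      · exact hadj.elim
      · rw [amalgam_adj_inl_inr] at hadj
        by_cases hlm : l = m
        · subst hlm
          rw [Line.apply_injective l.1 hadj]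
        · exact absurd ⟨⟨v, rfl⟩, Or.inr ⟨l, (hT l).2 ⟨u, hu⟩, hlm, u, hadj.symm⟩⟩ hvS
    rintro u ⟨hu, hadj⟩ u' ⟨hu', hadj'⟩
    rw [this u hu hadj, this u' hu' hadj']
  · refine ⟨.inr (m, v), (hR _ _).1 hv, (hmw v).symm, ?_⟩
    rintro (z | ⟨l, u⟩) ⟨h1, h2⟩ (z' | ⟨l', u'⟩) ⟨h1', h2'⟩
    · rw [amalgam_adj_inr_inl] at h2
      exact absurd (h2 ▸ h1) hy
    · rw [amalgam_adj_inr_inl] at h2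
      exact absurd (h2 ▸ h1) hy
    · rw [amalgam_adj_inr_inl] at h2'
      exact absurd (h2' ▸ h1') hy
    · obtain ⟨rfl, h2⟩ := h2
      obtain ⟨rfl, h2'⟩ := h2'
      rw [hvs ⟨(hR _ _).2 h1, h2⟩ ⟨(hR _ _).2 h1', h2'⟩]

end

/-- A class of finite graphs that contains the one-vertex graph and is closed under amalgams has
members of arbitrarily large girth and chromatic number. -/
theorem exists_isLocallyForest_not_colorable (R : ∀ V : Type, SimpleGraph V → Prop)
    (hR₀ : R Unit ⊥)
    (hR : ∀ (V ι : Type) (G : SimpleGraph V) (E : Set (Line V ι)), Finite V → Finite ι →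
      R V G → R _ (amalgam G E)) (g n : ℕ) :
    ∃ (V : Type) (G : SimpleGraph V), Finite V ∧ R V G ∧ G.IsLocallyForest g ∧ ¬ G.Colorable n := by
  induction n with
  | zero =>
    refine ⟨Unit, ⊥, inferInstance, hR₀, ?_, ?_⟩
    · intro W _ w₀ hw₀ hne
      exact absurd (Finset.eq_singleton_iff_unique_mem.2 ⟨hw₀, fun x _ => rfl⟩) hne
    · rintro ⟨C⟩
      exact (C ()).elim0
  | succ n ih =>
    obtain ⟨V, G, hV, hRG, hG, hn⟩ := ih
    obtain ⟨ι, _, E, hE, hsp⟩ := sparseHalesJewett g V (Fin (n + 1))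
    have : Finite (Line V ι) := Finite.of_injective Line.idxFun (fun l m h => Line.ext h)
    exact ⟨_, amalgam G E, inferInstance, hR V ι G E inferInstance inferInstance hRG,
      isLocallyForest_amalgam hG hsp, not_colorable_amalgam hn hE⟩

/-! ### Generic projection of the cube to the line -/

theorem exists_generic_weights {ι : Type} [Fintype ι] (D : Set (ι → ℝ)) (hD : D.Finite) :
    ∃ w : ι → ℝ, (∀ t, 0 < w t) ∧ ∀ d ∈ D, d ≠ 0 → ∑ t, w t * d t ≠ 0 := by
  classical
  let φ := Fintype.equivFin ι
  -- the powers of a positive number avoiding the roots of finitely many polynomials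
  let f : (ι → ℝ) → Polynomial ℝ := fun d => ∑ t, Polynomial.monomial (φ t : ℕ) (d t)
  have hf : ∀ d, d ≠ 0 → f d ≠ 0 := by
    intro d hd h
    apply hd
    funext t
    have := congrArg (fun P => Polynomial.coeff P (φ t)) h
    simpa [f, Polynomial.finsetSum_coeff, Polynomial.coeff_monomial, Fin.val_inj] using this
  have hfin : (⋃ d ∈ D, ((f d).roots.toFinset : Set ℝ)).Finite :=
    hD.biUnion fun d _ => Finset.finite_toSet _
  obtain ⟨x, hx0, hx⟩ := ((Set.Ioi_infinite (0 : ℝ)).sdiff hfin).nonempty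
  refine ⟨fun t => x ^ (φ t : ℕ), fun t => pow_pos hx0 _, fun d hd hd0 h => hx ?_⟩
  rw [Set.mem_iUnion₂]
  refine ⟨d, hd, ?_⟩
  simp only [Finset.mem_coe, Multiset.mem_toFinset, Polynomial.mem_roots (hf d hd0),
    Polynomial.IsRoot, f, Polynomial.eval_finsetSum, Polynomial.eval_monomial]
  rw [← h]
  exact Finset.sum_congr rfl fun t _ => mul_comm _ _

/-- Mapping the cube `ι → V` to the real line by `z ↦ ∑ t, w t * pos (z t)` with generic positive
weights turns every combinatorial line into a homothetic copy of `pos`. The copy of an additional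
point `conj v` does not hit the image of the cube, unless `conj v = pos v`. -/
theorem exists_generic_projection {V ι : Type} [Finite V] [Finite ι] (pos conj : V → ℝ)
    (hpos : pos.Injective) (hconj : ∀ u v, u ≠ v → conj u ≠ pos v) :
    ∃ (y : (ι → V) → ℝ) (slope shift : Line V ι → ℝ), y.Injective ∧ (∀ l, 0 < slope l) ∧
      ∀ l v z, (y z = slope l * pos v + shift l ∨ y z = slope l * conj v + shift l) ↔
        z = l v := by
  classical
  cases nonempty_fintype ι
  have : Finite (Line V ι) := Finite.of_injective Line.idxFun (fun l m h => Line.ext h)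
  let conjPt : Line V ι → V → ι → ℝ := fun l v t => (l.idxFun t).elim (conj v) pos
  let D : Set (ι → ℝ) :=
    Set.range (fun zz : (ι → V) × (ι → V) => fun t => pos (zz.1 t) - pos (zz.2 t)) ∪
    Set.range (fun zz : (ι → V) × Line V ι × V => fun t =>
      pos (zz.1 t) - conjPt zz.2.1 zz.2.2 t)
  obtain ⟨w, hw, hwD⟩ := exists_generic_weights D ((Set.finite_range _).union (Set.finite_range _))
  let y : (ι → V) → ℝ := fun z => ∑ t, w t * pos (z t)
  have hy : y.Injective := by
    intro z z' hzz
    by_contra hne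
    refine hwD _ (Or.inl ⟨(z, z'), rfl⟩) ?_ ?_
    · intro h
      exact hne (funext fun t => hpos (sub_eq_zero.1 (congrFun h t)))
    · simp only [mul_sub, Finset.sum_sub_distrib]
      exact sub_eq_zero.2 hzz
  let slope : Line V ι → ℝ := fun l => ∑ t, w t * (l.idxFun t).elim 1 (fun _ => 0)
  let shift : Line V ι → ℝ := fun l => ∑ t, w t * (l.idxFun t).elim 0 pos
  have hline : ∀ l v, y (l v) = slope l * pos v + shift l := by
    intro l v
    simp only [y, slope, shift, Finset.sum_mul, ← Finset.sum_add_distrib]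
    refine Finset.sum_congr rfl fun t _ => ?_
    cases h : l.idxFun t <;> simp [h]
  have hconjPt : ∀ l v, ∑ t, w t * conjPt l v t = slope l * conj v + shift l := by
    intro l v
    simp only [conjPt, slope, shift, Finset.sum_mul, ← Finset.sum_add_distrib]
    refine Finset.sum_congr rfl fun t _ => ?_
    cases h : l.idxFun t <;> simp
  refine ⟨y, slope, shift, hy, fun l => ?_, fun l v z => ⟨?_, fun h => Or.inl (h ▸ hline l v)⟩⟩
  · obtain ⟨t, ht⟩ := l.proper
    refine Finset.sum_pos' (fun s _ => ?_) ⟨t, Finset.mem_univ _, by simp [ht, hw t]⟩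
    cases h : l.idxFun s <;> simp [(hw s).le]
  · rintro (h | h)
    · exact hy (h.trans (hline l v).symm)
    · by_cases hpc : conj v = pos v
      · rw [hpc] at h
        exact hy (h.trans (hline l v).symm)
      · exfalso
        refine hwD _ (Or.inr ⟨(z, l, v), rfl⟩) ?_ ?_
        · intro h0
          obtain ⟨t, ht⟩ := l.proper
          have h1 : pos (z t) = conj v := by
            simpa [conjPt, ht] using sub_eq_zero.1 (congrFun h0 t)
          by_cases hzv : v = z t
          · subst hzv
            exact hpc h1.symm
          · exact hconj v (z t) hzv h1.symm
        · simp only [mul_sub, Finset.sum_sub_distrib]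
          rw [hconjPt, ← h]
          exact sub_self _

open Filter

/-! ### Circles meeting at a positive angle -/

theorem eventually_quartic_ne_zero {a b c d e : ℝ}
    (h : a ≠ 0 ∨ b ≠ 0 ∨ c ≠ 0 ∨ d ≠ 0 ∨ e ≠ 0) :
    ∀ᶠ s : ℝ in atTop, a * s ^ 4 + b * s ^ 3 + c * s ^ 2 + d * s + e ≠ 0 := by
  let P : Polynomial ℝ := .C a * .X ^ 4 + .C b * .X ^ 3 + .C c * .X ^ 2 + .C d * .X + .C e
  have hP : P ≠ 0 := by
    intro h0
    have hc : ∀ n, P.coeff n = 0 := fun n => by rw [h0, Polynomial.coeff_zero]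
    have h4 := hc 4
    have h3 := hc 3
    have h2 := hc 2
    have h1 := hc 1
    have h0' := hc 0
    simp [P, Polynomial.coeff_X, Polynomial.coeff_C] at h4 h3 h2 h1 h0'
    tauto
  filter_upwards [P.eventually_atTop_not_isRoot hP] with s hs h0
  apply hs
  simpa [P, Polynomial.IsRoot] using h0

theorem eventually_lt_sq (a B : ℝ) {k : ℝ} (hk : k ≠ 0) :
    ∀ᶠ T : ℝ in atTop, B < (a + T * k) ^ 2 := by
  have hk' : 0 < |k| := abs_pos.2 hk
  filter_upwards [eventually_gt_atTop ((|a| + |B| + 1) / |k|), eventually_ge_atTop 0] with T hT hT0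
  rw [div_lt_iff₀ hk'] at hT
  have h1 : T * |k| = |T * k| := by rw [abs_mul, abs_of_nonneg hT0]
  have h2 : |T * k| ≤ |a + T * k| + |a| := by
    have := abs_sub (a + T * k) a
    rwa [add_sub_cancel_left] at this
  have h3 : |B| + 1 < |a + T * k| := by linarith
  rw [← sq_abs (a + T * k)]
  nlinarith [abs_nonneg B, le_abs_self B]

/-- The vertices of `G` are represented by distinct circles, with centre `(x v, y v)` and radius
`r v`, such that adjacency in `G` means that the circles meet at the angle with cosine `c`,
expressed by the law of cosines (up to the sign of the cosine). -/
def RealizedAtAngle (c : ℝ) (V : Type) (G : SimpleGraph V) : Prop :=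
  ∃ x y r : V → ℝ, (∀ v, 0 < r v) ∧
    (∀ u v, x u = x v → y u = y v → r u = r v → u = v) ∧
    ∀ u v, u ≠ v → (G.Adj u v ↔
      ((x u - x v) ^ 2 + (y u - y v) ^ 2 - r u ^ 2 - r v ^ 2) ^ 2 = (2 * c * r u * r v) ^ 2)

theorem realizedAtAngle_unit (c : ℝ) : RealizedAtAngle c Unit ⊥ :=
  ⟨fun _ => 0, fun _ => 0, fun _ => 1, fun _ => one_pos, fun _ _ _ _ _ => rfl,
    fun _ _ h => absurd rfl h⟩

/-- The inversion in the unit circle takes the circle with centre `(x, y)` and radius `r` to the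
circle with centre `(x / A, y / A)` and radius `r / |A|`, where `A = x ^ 2 + y ^ 2 - r ^ 2`, and it
preserves angles. -/
theorem inversion_angle_iff (c : ℝ) {x y r x' y' r' A A' : ℝ} (hA : A = x ^ 2 + y ^ 2 - r ^ 2)
    (hA' : A' = x' ^ 2 + y' ^ 2 - r' ^ 2) (h : A ≠ 0) (h' : A' ≠ 0) :
    ((x / A - x' / A') ^ 2 + (y / A - y' / A') ^ 2 - (r / |A|) ^ 2 - (r' / |A'|) ^ 2) ^ 2 =
        (2 * c * (r / |A|) * (r' / |A'|)) ^ 2 ↔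
      ((x - x') ^ 2 + (y - y') ^ 2 - r ^ 2 - r' ^ 2) ^ 2 = (2 * c * r * r') ^ 2 := by
  have e1 : (x / A - x' / A') ^ 2 + (y / A - y' / A') ^ 2 - (r / |A|) ^ 2 - (r' / |A'|) ^ 2 =
      ((x - x') ^ 2 + (y - y') ^ 2 - r ^ 2 - r' ^ 2) / (A * A') := by
    rw [div_pow r, div_pow r', sq_abs, sq_abs]
    have : (x / A - x' / A') ^ 2 + (y / A - y' / A') ^ 2 - r ^ 2 / A ^ 2 - r' ^ 2 / A' ^ 2 =
        (x ^ 2 + y ^ 2 - r ^ 2) / A ^ 2 + (x' ^ 2 + y' ^ 2 - r' ^ 2) / A' ^ 2 -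
          2 * (x * x' + y * y') / (A * A') := by
      field_simp
      ring
    rw [this, ← hA, ← hA']
    have : (x - x') ^ 2 + (y - y') ^ 2 - r ^ 2 - r' ^ 2 = A + A' - 2 * (x * x' + y * y') := by
      rw [hA, hA']
      ring
    rw [this]
    field_simp
    ring
  have e2 : (2 * c * (r / |A|) * (r' / |A'|)) ^ 2 = (2 * c * r * r') ^ 2 / (A * A') ^ 2 := by
    simp only [mul_pow, div_pow, sq_abs]
    field_simp
  rw [e1, e2, div_pow, div_left_inj' (by positivity)]

/-- A circle is determined by its image under inversion. -/
theorem inversion_injective {x y r x' y' r' A A' : ℝ} (hA : A = x ^ 2 + y ^ 2 - r ^ 2)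
    (hA' : A' = x' ^ 2 + y' ^ 2 - r' ^ 2) (h : A ≠ 0) (h' : A' ≠ 0) (hx : x / A = x' / A')
    (hy : y / A = y' / A') (hr : r / |A| = r' / |A'|) : x = x' ∧ y = y' ∧ r = r' := by
  have key : ∀ {x y r A : ℝ}, A = x ^ 2 + y ^ 2 - r ^ 2 → A ≠ 0 →
      (x / A) ^ 2 + (y / A) ^ 2 - (r / |A|) ^ 2 = A⁻¹ := by
    intro x y r A hA h
    rw [div_pow r, sq_abs]
    have : (x / A) ^ 2 + (y / A) ^ 2 - r ^ 2 / A ^ 2 = (x ^ 2 + y ^ 2 - r ^ 2) / A ^ 2 := by ring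
    rw [this, ← hA]
    field_simp
  have hAA : A = A' := by
    rw [← inv_inj, ← key hA h, ← key hA' h', hx, hy, hr]
  subst hAA
  exact ⟨(div_left_inj' h).1 hx, (div_left_inj' h).1 hy, (div_left_inj' (abs_ne_zero.2 h)).1 hr⟩

/-- A realization can be moved by an inversion such that no two circles are concentric: it suffices
that the centre of inversion is not on one of the circles, not a centre, and not collinear with
the centres of two non-concentric circles. -/
theorem RealizedAtAngle.exists_distinct_centers {c : ℝ} {V : Type} [Finite V] {G : SimpleGraph V}
    (h : RealizedAtAngle c V G) :
    ∃ x y r : V → ℝ, (∀ v, 0 < r v) ∧ (∀ u v, u ≠ v → x u - x v ≠ 0 ∨ y u - y v ≠ 0) ∧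
    ∀ u v, u ≠ v → (G.Adj u v ↔
      ((x u - x v) ^ 2 + (y u - y v) ^ 2 - r u ^ 2 - r v ^ 2) ^ 2 = (2 * c * r u * r v) ^ 2) := by
  obtain ⟨x, y, r, hr, hinj, hadj⟩ := h
  -- the centre of inversion is taken far out on the parabola `(s, s ^ 2)`
  have h1 : ∀ᶠ s : ℝ in atTop, ∀ v, (x v - s) ^ 2 + (y v - s ^ 2) ^ 2 - r v ^ 2 ≠ 0 := by
    rw [eventually_all]
    intro v
    filter_upwards [eventually_quartic_ne_zero (a := 1) (b := 0) (c := 1 - 2 * y v)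
      (d := - 2 * x v) (e := x v ^ 2 + y v ^ 2 - r v ^ 2) (Or.inl one_ne_zero)] with s hs h
    apply hs
    linear_combination h
  have h2 : ∀ᶠ s : ℝ in atTop, ∀ v, x v - s ≠ 0 := by
    rw [eventually_all]
    intro v
    filter_upwards [eventually_gt_atTop (x v)] with s hs h
    linarith
  have h3 : ∀ᶠ s : ℝ in atTop, ∀ u v, (x u ≠ x v ∨ y u ≠ y v) →
      (x u - s) * (y v - s ^ 2) - (x v - s) * (y u - s ^ 2) ≠ 0 := by
    rw [eventually_all]
    intro u
    rw [eventually_all]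
    intro v
    by_cases hne : x u ≠ x v ∨ y u ≠ y v
    · filter_upwards [eventually_quartic_ne_zero (a := 0) (b := 0) (c := x v - x u)
        (d := y u - y v) (e := x u * y v - x v * y u) (by
          rcases hne with h | h
          · exact Or.inr (Or.inr (Or.inl (sub_ne_zero.2 h.symm)))
          · exact Or.inr (Or.inr (Or.inr (Or.inl (sub_ne_zero.2 h)))))] with s hs _ h
      apply hs
      linear_combination h
    · exact Eventually.of_forall fun s hs => absurd hs hne
  obtain ⟨s, hs1, hs2, hs3⟩ := (h1.and (h2.and h3)).exists
  let A : V → ℝ := fun v => (x v - s) ^ 2 + (y v - s ^ 2) ^ 2 - r v ^ 2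
  refine ⟨fun v => (x v - s) / A v, fun v => (y v - s ^ 2) / A v, fun v => r v / |A v|,
    fun v => div_pos (hr v) (abs_pos.2 (hs1 v)), ?_, ?_⟩
  · intro u v huv
    by_contra! hcon
    obtain ⟨hx, hy⟩ := hcon
    rw [sub_eq_zero] at hx hy
    have hu := hs1 u
    have hv := hs1 v
    by_cases hne : x u ≠ x v ∨ y u ≠ y v
    · apply hs3 u v hne
      change A u ≠ 0 at hu
      change A v ≠ 0 at hv
      have e1 : x u - s = (x v - s) / A v * A u := by rw [← hx, div_mul_cancel₀ _ hu]
      have e2 : y u - s ^ 2 = (y v - s ^ 2) / A v * A u := by rw [← hy, div_mul_cancel₀ _ hu]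
      rw [e1, e2]
      ring
    · push Not at hne
      obtain ⟨hxe, hye⟩ := hne
      have hAA : A u = A v := by
        rw [hxe, div_eq_div_iff hu hv] at hx
        exact (mul_left_cancel₀ (hs2 v) hx).symm
      have hrr : r u ^ 2 = r v ^ 2 := by
        simp only [A, hxe, hye] at hAA
        linarith
      exact huv (hinj u v hxe hye ((sq_eq_sq₀ (hr u).le (hr v).le).1 hrr))
  · intro u v huv
    rw [hadj u v huv, inversion_angle_iff c rfl rfl (hs1 u) (hs1 v)]
    simp only [sub_sub_sub_cancel_right]

/-- The vertical lines with abscissa `x v ± c * r v` are those that meet the circle of `v` at the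
angle with cosine `c`. After a rotation, such lines are distinct for different circles, except that
`x u - c * r u` may coincide with `x v - c * r v`. -/
theorem RealizedAtAngle.exists_distinct_projections {c : ℝ} {V : Type} [Finite V]
    {G : SimpleGraph V} (h : RealizedAtAngle c V G) :
    ∃ x y r : V → ℝ, (∀ v, 0 < r v) ∧ (∀ u v, u ≠ v → x u + c * r u ≠ x v + c * r v) ∧
    (∀ u v, u ≠ v → x u - c * r u ≠ x v + c * r v) ∧
    ∀ u v, u ≠ v → (G.Adj u v ↔
      ((x u - x v) ^ 2 + (y u - y v) ^ 2 - r u ^ 2 - r v ^ 2) ^ 2 = (2 * c * r u * r v) ^ 2) := by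
  obtain ⟨x, y, r, hr, hcen, hadj⟩ := h.exists_distinct_centers
  -- the plane is multiplied by the complex number `(1 + m * I) ^ 2` of norm `1 + m ^ 2`
  have key : ∀ k : V → V → ℝ, ∀ᶠ m : ℝ in atTop, ∀ u v, u ≠ v →
      (1 - m ^ 2) * (x u - x v) - 2 * m * (y u - y v) + (1 + m ^ 2) * k u v ≠ 0 := by
    intro k
    rw [eventually_all]
    intro u
    rw [eventually_all]
    intro v
    by_cases huv : u = v
    · exact Eventually.of_forall fun s hs => absurd huv hs
    filter_upwards [eventually_quartic_ne_zero (a := 0) (b := 0) (c := k u v - (x u - x v))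
      (d := -2 * (y u - y v)) (e := (x u - x v) + k u v) (by
        by_contra! h0
        obtain ⟨-, -, h0c, h0d, h0e⟩ := h0
        rcases hcen u v huv with h | h
        · exact h (by linarith)
        · exact h (by linarith))] with m hm _ h
    apply hm
    linear_combination h
  obtain ⟨m, hm1, hm2⟩ := ((key fun u v => c * (r u - r v)).and
    (key fun u v => c * (- r u - r v))).exists
  have hm : 0 < 1 + m ^ 2 := by positivity
  refine ⟨fun v => (1 - m ^ 2) * x v - 2 * m * y v, fun v => 2 * m * x v + (1 - m ^ 2) * y v,
    fun v => (1 + m ^ 2) * r v, fun v => mul_pos hm (hr v), ?_, ?_, ?_⟩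
  · intro u v huv h
    apply hm1 u v huv
    linear_combination h
  · intro u v huv h
    apply hm2 u v huv
    linear_combination h
  · intro u v huv
    rw [hadj u v huv, ← mul_right_inj' (pow_ne_zero 4 hm.ne')]
    constructor <;> intro h <;> linear_combination h

/-- The vertical lines with abscissas `h` and `h'` become circles under inversion that touch each
other, so they do not meet at an angle with cosine `c < 1`. -/
theorem inverted_lines_not_angle {c h h' : ℝ} (hc0 : 0 ≤ c) (hc1 : c < 1) (hh : 0 < h)
    (hh' : 0 < h') :
    ¬ ((1 / (2 * h) - 1 / (2 * h')) ^ 2 + (0 - 0) ^ 2 - (1 / (2 * h)) ^ 2 -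
      (1 / (2 * h')) ^ 2) ^ 2 = (2 * c * (1 / (2 * h)) * (1 / (2 * h'))) ^ 2 := by
  intro heq
  have e : (1 / (2 * h) * (1 / (2 * h'))) ^ 2 * (1 - c ^ 2) = 0 := by linear_combination heq / 4
  have h1 : 0 < (1 / (2 * h) * (1 / (2 * h'))) ^ 2 := by positivity
  have h2 : 0 < 1 - c ^ 2 := by nlinarith
  exact (mul_pos h1 h2).ne' e

theorem inverted_line_angle_iff {c h x y r A : ℝ} (hh : 0 < h)
    (hA : A = x ^ 2 + y ^ 2 - r ^ 2) (hA0 : A ≠ 0) :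
    ((1 / (2 * h) - x / A) ^ 2 + (0 - y / A) ^ 2 - (1 / (2 * h)) ^ 2 - (r / |A|) ^ 2) ^ 2 =
        (2 * c * (1 / (2 * h)) * (r / |A|)) ^ 2 ↔
      h = x + c * r ∨ h = x - c * r := by
  have e1 : (1 / (2 * h) - x / A) ^ 2 + (0 - y / A) ^ 2 - (1 / (2 * h)) ^ 2 - (r / |A|) ^ 2 =
      (h - x) / (A * h) := by
    rw [div_pow r, sq_abs]
    have : (1 / (2 * h) - x / A) ^ 2 + (0 - y / A) ^ 2 - (1 / (2 * h)) ^ 2 - r ^ 2 / A ^ 2 =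
        (x ^ 2 + y ^ 2 - r ^ 2) / A ^ 2 - x / (A * h) := by
      field_simp
      ring
    rw [this, ← hA]
    field_simp
  have e2 : (2 * c * (1 / (2 * h)) * (r / |A|)) ^ 2 = (c * r) ^ 2 / (A * h) ^ 2 := by
    simp only [mul_pow, div_pow, sq_abs]
    field_simp
  rw [e1, e2, div_pow, div_left_inj' (by positivity), sq_eq_sq_iff_eq_or_eq_neg]
  constructor
  · rintro (h | h)
    · exact Or.inl (by linarith)
    · exact Or.inr (by linarith)
  · rintro (h | h)
    · exact Or.inl (by linarith)
    · exact Or.inr (by linarith)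

theorem not_angle_of_disjoint {c D r r' : ℝ} (hc0 : 0 ≤ c) (hc1 : c < 1) (hr : 0 < r)
    (hr' : 0 < r') (hD : (r + r') ^ 2 < D) : ¬ (D - r ^ 2 - r' ^ 2) ^ 2 = (2 * c * r * r') ^ 2 := by
  intro h
  have h0 : 0 < r * r' := mul_pos hr hr'
  have h1 : 2 * (r * r') < D - r ^ 2 - r' ^ 2 := by linarith
  have h2 : (2 * (r * r')) ^ 2 < (D - r ^ 2 - r' ^ 2) ^ 2 := by
    apply pow_lt_pow_left₀ h1 (by positivity) two_ne_zero
  have h3 : (2 * c * r * r') ^ 2 ≤ (2 * (r * r')) ^ 2 := by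
    apply pow_le_pow_left₀ (by positivity)
    nlinarith
  linarith

/-- For a positive angle, the class of realizable graphs is closed under amalgams. The points of
the cube are represented by parallel lines (turned into circles by an inversion), and the copies
of `G` by homothetic copies of a realization of `G`, which are moved apart along the lines. -/
theorem RealizedAtAngle.amalgam {c : ℝ} (hc0 : 0 ≤ c) (hc1 : c < 1) {V ι : Type}
    {G : SimpleGraph V} {E : Set (Line V ι)} [Finite V] [Finite ι] (h : RealizedAtAngle c V G) :
    RealizedAtAngle c _ (amalgam G E) := by
  classical
  obtain ⟨x, y, r, hr, hpos, hconj, hadj⟩ := h.exists_distinct_projections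
  have hinj : Function.Injective fun v => x v + c * r v := by
    intro u v huv
    by_contra hne
    exact hpos u v hne huv
  obtain ⟨p, slope, shift, hp, hslope, hline⟩ :=
    exists_generic_projection (ι := ι) (fun v => x v + c * r v) (fun v => x v - c * r v) hinj hconj
  have : Finite (Line V ι) := Finite.of_injective Line.idxFun (fun l m h => Line.ext h)
  obtain ⟨n, ⟨φ⟩⟩ := Finite.exists_equiv_fin E
  -- `K` moves all lines into the right half-plane
  obtain ⟨K, hK⟩ : ∃ K, ∀ z, 0 < p z + K := by
    obtain ⟨B, hB⟩ := (Set.finite_range p).bddBelow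
    refine ⟨1 - B, fun z => ?_⟩
    have := hB ⟨z, rfl⟩
    linarith
  let k : E → ℝ := fun l => (φ l : ℕ) + 1
  have hk : ∀ l, k l ≠ 0 := fun l => by positivity
  have hkk : ∀ l m, l ≠ m → k l - k m ≠ 0 := by
    intro l m hlm h
    apply hlm
    apply φ.injective
    apply Fin.ext
    have : ((φ l : ℕ) : ℝ) = (φ m : ℕ) := by
      simp only [k] at h
      linarith
    exact_mod_cast this
  let X : E × V → ℝ := fun t => slope t.1.1 * x t.2 + shift t.1.1 + K
  let R : E × V → ℝ := fun t => slope t.1.1 * r t.2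
  have hT1 : ∀ᶠ T : ℝ in atTop, ∀ t : E × V,
      R t ^ 2 - X t ^ 2 < (slope t.1.1 * y t.2 + T * k t.1) ^ 2 := by
    rw [eventually_all]
    exact fun t => eventually_lt_sq _ _ (hk t.1)
  have hT2 : ∀ᶠ T : ℝ in atTop, ∀ t t' : E × V, t.1 ≠ t'.1 → (R t + R t') ^ 2 <
      ((slope t.1.1 * y t.2 - slope t'.1.1 * y t'.2) + T * (k t.1 - k t'.1)) ^ 2 := by
    rw [eventually_all]
    intro t
    rw [eventually_all]
    intro t'
    by_cases htt : t.1 = t'.1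
    · exact Eventually.of_forall fun s hs => absurd htt hs
    · filter_upwards [eventually_lt_sq (slope t.1.1 * y t.2 - slope t'.1.1 * y t'.2)
        ((R t + R t') ^ 2) (hkk _ _ htt)] with T hT _
      exact hT
  obtain ⟨T, hT1, hT2⟩ := (hT1.and hT2).exists
  let Y : E × V → ℝ := fun t => slope t.1.1 * y t.2 + T * k t.1
  have hYY : ∀ t t', t.1 ≠ t'.1 → (R t + R t') ^ 2 < (Y t - Y t') ^ 2 := by
    intro t t' htt
    have := hT2 t t' htt
    simp only [Y]
    convert this using 2
    ring
  let A : E × V → ℝ := fun t => X t ^ 2 + Y t ^ 2 - R t ^ 2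
  have hA : ∀ t, A t ≠ 0 := by
    intro t
    have := hT1 t
    simp only [A, Y]
    apply ne_of_gt
    linarith
  have hR : ∀ t, 0 < R t := fun t => mul_pos (hslope _) (hr _)
  have hcross : ∀ z (l : E) v, ((1 / (2 * (p z + K)) - X (l, v) / A (l, v)) ^ 2 +
      (0 - Y (l, v) / A (l, v)) ^ 2 - (1 / (2 * (p z + K))) ^ 2 -
      (R (l, v) / |A (l, v)|) ^ 2) ^ 2 =
        (2 * c * (1 / (2 * (p z + K))) * (R (l, v) / |A (l, v)|)) ^ 2 ↔ z = l.1 v := by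
    intro z l v
    rw [inverted_line_angle_iff (hK z) rfl (hA (l, v)), ← hline l.1 v z]
    simp only [X, R]
    constructor
    · rintro (h | h)
      · exact Or.inl (by linarith)
      · exact Or.inr (by linarith)
    · rintro (h | h)
      · exact Or.inl (by linarith)
      · exact Or.inr (by linarith)
  refine ⟨Sum.elim (fun z => 1 / (2 * (p z + K))) (fun t => X t / A t),
    Sum.elim (fun _ => 0) (fun t => Y t / A t),
    Sum.elim (fun z => 1 / (2 * (p z + K))) (fun t => R t / |A t|), ?_, ?_, ?_⟩
  · rintro (z | t)
    · have := hK z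
      simp only [Sum.elim_inl]
      positivity
    · exact div_pos (hR t) (abs_pos.2 (hA t))
  · have hmixed : ∀ z t, 1 / (2 * (p z + K)) = X t / A t → 0 = Y t / A t →
        1 / (2 * (p z + K)) = R t / |A t| → False := by
      intro z t hx hy hr'
      -- the inverted lines pass through the origin, the other circles do not
      have h1 : (X t / A t) ^ 2 + (Y t / A t) ^ 2 - (R t / |A t|) ^ 2 = 0 := by
        rw [← hx, ← hy, ← hr']
        ring
      rw [div_pow, div_pow, div_pow, sq_abs, ← add_div, ← sub_div] at h1
      exact div_ne_zero (hA t) (pow_ne_zero 2 (hA t)) h1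
    rintro (z | t) (z' | t') hx hy hr'
    · simp only [Sum.elim_inl] at hx
      have h1 : 2 * (p z + K) = 2 * (p z' + K) := by
        rwa [one_div, one_div, inv_inj] at hx
      rw [hp (by linarith : p z = p z')]
    · exact (hmixed z t' hx hy hr').elim
    · exact (hmixed z' t hx.symm hy.symm hr'.symm).elim
    · obtain ⟨hX, hY, hR'⟩ := inversion_injective (r := R t) (r' := R t') rfl rfl (hA t) (hA t')
        hx hy hr'
      obtain ⟨l, v⟩ := t
      obtain ⟨l', v'⟩ := t'
      by_cases hll : l = l'
      · subst hll
        have hs := (hslope l.1).ne'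
        have h1 : x v = x v' := mul_left_cancel₀ hs (by
          simp only [X] at hX
          linarith)
        have h2 : r v = r v' := mul_left_cancel₀ hs hR'
        have : v = v' := hinj (by simp only [h1, h2])
        rw [this]
      · have h1 := hYY (l, v) (l', v') hll
        rw [hY, sub_self] at h1
        nlinarith [sq_nonneg (R (l, v) + R (l', v'))]
  · rintro (z | ⟨l, v⟩) (z' | ⟨l', v'⟩) hne
    · simp only [amalgam_adj_inl_inl, Sum.elim_inl, false_iff]
      exact inverted_lines_not_angle hc0 hc1 (hK z) (hK z')
    · simp only [amalgam_adj_inl_inr, Sum.elim_inl, Sum.elim_inr]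
      exact (hcross z l' v').symm
    · simp only [amalgam_adj_inr_inl, Sum.elim_inl, Sum.elim_inr]
      rw [← hcross z' l v]
      constructor <;> intro h <;> linear_combination h
    · simp only [amalgam_adj_inr_inr, Sum.elim_inr]
      rw [inversion_angle_iff c rfl rfl (hA (l, v)) (hA (l', v'))]
      by_cases hll : l = l'
      · subst hll
        have hvv : v ≠ v' := fun h => hne (by rw [h])
        rw [hadj v v' hvv, ← mul_right_inj' (pow_ne_zero 4 (hslope l.1).ne')]
        simp only [X, Y, R, true_and]
        constructor <;> intro h <;> linear_combination h
      · simp only [hll, false_and, false_iff]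
        refine not_angle_of_disjoint hc0 hc1 (hR _) (hR _) ((hYY _ _ hll).trans_le ?_)
        nlinarith [sq_nonneg (X (l, v) - X (l', v'))]

/-! ### Tangent circles -/

/-- The vertices of `G` are represented by distinct points with light-cone coordinates
`(x v, p v, n v)` in three-dimensional Minkowski space, such that adjacency in `G` means that the
difference of the points is lightlike. A circle with centre `(x, y)` and radius `r` corresponds to
`(x, r + y, r - y)`, and the difference is lightlike if the circles touch from the inside. The
radius may be negative here; adding a constant to all radii makes it positive. -/
def RealizedByLightlike (V : Type) (G : SimpleGraph V) : Prop :=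
  ∃ x p n : V → ℝ, (∀ u v, x u = x v → p u = p v → n u = n v → u = v) ∧
    ∀ u v, u ≠ v → (G.Adj u v ↔ (x u - x v) ^ 2 = (p u - p v) * (n u - n v))

theorem realizedByLightlike_unit : RealizedByLightlike Unit ⊥ :=
  ⟨fun _ => 0, fun _ => 0, fun _ => 0, fun _ _ _ _ _ => rfl, fun _ _ h => absurd rfl h⟩

/-- The points `(a, 0, 0)` with `a = x v ± √(p v * n v)` are those at lightlike distance from the
point of `v`. After a Lorentz transformation and a translation they exist and are distinct for
different vertices, except that `x u - √(p u * n u)` may coincide with `x v - √(p v * n v)`. -/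
theorem RealizedByLightlike.exists_distinct_projections {V : Type} [Finite V]
    {G : SimpleGraph V} (h : RealizedByLightlike V G) :
    ∃ x p n : V → ℝ, (∀ v, 0 < p v) ∧ (∀ v, 0 < n v) ∧
    (∀ u v, u ≠ v → x u + √(p u * n u) ≠ x v + √(p v * n v)) ∧
    (∀ u v, u ≠ v → x u - √(p u * n u) ≠ x v + √(p v * n v)) ∧
    ∀ u v, u ≠ v → (G.Adj u v ↔ (x u - x v) ^ 2 = (p u - p v) * (n u - n v)) := by
  obtain ⟨x, p, n, hinj, hadj⟩ := h
  -- a boost, combined with a scaling by `s`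
  have hs : ∀ᶠ s : ℝ in atTop, ∀ u v, u ≠ v →
      4 * (s * x u - s * x v) ^ 2 - (s ^ 2 * p u - s ^ 2 * p v + (n u - n v)) ^ 2 ≠ 0 := by
    rw [eventually_all]
    intro u
    rw [eventually_all]
    intro v
    by_cases huv : u = v
    · exact Eventually.of_forall fun s hs => absurd huv hs
    filter_upwards [eventually_quartic_ne_zero (a := -(p u - p v) ^ 2) (b := 0)
      (c := 4 * (x u - x v) ^ 2 - 2 * (p u - p v) * (n u - n v)) (d := 0)
      (e := -(n u - n v) ^ 2) (by
        by_contra! h0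
        obtain ⟨h0a, -, h0c, -, h0e⟩ := h0
        have hp : p u - p v = 0 := by simpa using h0a
        have hn : n u - n v = 0 := by simpa using h0e
        have hx : x u - x v = 0 := by simpa [hp] using h0c
        exact huv (hinj u v (sub_eq_zero.1 hx) (sub_eq_zero.1 hp) (sub_eq_zero.1 hn)))]
      with s hs _ h
    apply hs
    linear_combination h
  obtain ⟨s, hs, hs0⟩ := (hs.and (eventually_gt_atTop 0)).exists
  obtain ⟨x', hx'⟩ : ∃ x' : V → ℝ, ∀ v, x' v = s * x v := ⟨_, fun _ => rfl⟩
  obtain ⟨p', hp'⟩ : ∃ p' : V → ℝ, ∀ v, p' v = s ^ 2 * p v := ⟨_, fun _ => rfl⟩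
  -- a translation by `τ` in the time direction
  have hτ : ∀ᶠ τ : ℝ in atTop, ∀ u v, u ≠ v →
      4 * (x' u - x' v) ^ 2 * ((p' u + τ) * (n u + τ)) -
        ((p' v + τ) * (n v + τ) - (p' u + τ) * (n u + τ) - (x' u - x' v) ^ 2) ^ 2 ≠ 0 := by
    rw [eventually_all]
    intro u
    rw [eventually_all]
    intro v
    by_cases huv : u = v
    · exact Eventually.of_forall fun s hs => absurd huv hs
    have h2 := hs u v huv
    simp only [← hx', ← hp'] at h2
    let δ := p' v + n v - (p' u + n u)
    let ε := p' v * n v - p' u * n u - (x' u - x' v) ^ 2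
    filter_upwards [eventually_quartic_ne_zero (a := 0) (b := 0)
      (c := 4 * (x' u - x' v) ^ 2 - δ ^ 2)
      (d := 4 * (x' u - x' v) ^ 2 * (p' u + n u) - 2 * δ * ε)
      (e := 4 * (x' u - x' v) ^ 2 * (p' u * n u) - ε ^ 2) (by
        refine Or.inr (Or.inr (Or.inl fun h => h2 ?_))
        simp only [δ] at h
        linear_combination h)] with τ hτ _ h
    apply hτ
    simp only [δ, ε]
    linear_combination h
  have hp0 : ∀ᶠ τ : ℝ in atTop, ∀ v, 0 < p' v + τ := by
    rw [eventually_all]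
    intro v
    filter_upwards [eventually_gt_atTop (-p' v)] with τ hτ
    linarith
  have hn0 : ∀ᶠ τ : ℝ in atTop, ∀ v, 0 < n v + τ := by
    rw [eventually_all]
    intro v
    filter_upwards [eventually_gt_atTop (-n v)] with τ hτ
    linarith
  obtain ⟨τ, hτ, hp0, hn0⟩ := (hτ.and (hp0.and hn0)).exists
  have hsq : ∀ v, √((p' v + τ) * (n v + τ)) ^ 2 = (p' v + τ) * (n v + τ) := fun v =>
    Real.sq_sqrt (mul_pos (hp0 v) (hn0 v)).le
  refine ⟨x', fun v => p' v + τ, fun v => n v + τ, hp0, hn0, ?_, ?_, ?_⟩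
  · intro u v huv h
    apply hτ u v huv
    have e : √((p' v + τ) * (n v + τ)) = x' u - x' v + √((p' u + τ) * (n u + τ)) := by linarith
    rw [← hsq u, ← hsq v, e]
    ring
  · intro u v huv h
    apply hτ u v huv
    have e : √((p' v + τ) * (n v + τ)) = x' u - x' v - √((p' u + τ) * (n u + τ)) := by linarith
    rw [← hsq u, ← hsq v, e]
    ring
  · intro u v huv
    simp only [hx', hp']
    rw [hadj u v huv, ← mul_right_inj' (pow_ne_zero 2 hs0.ne')]
    constructor <;> intro h <;> linear_combination h

/-- The points of the cube are represented by points on a spacelike line, and the copies of `G` by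
homothetic copies of a realization of `G`. Boosts in the orthogonal plane fix the line pointwise, and
strong enough boosts by factors `T ^ k` make the distances between different copies spacelike. -/
theorem RealizedByLightlike.amalgam {V ι : Type}
    {G : SimpleGraph V} {E : Set (Line V ι)} [Finite V] [Finite ι] (h : RealizedByLightlike V G) :
    RealizedByLightlike _ (amalgam G E) := by
  classical
  obtain ⟨x, p, n, hp, hn, hpos, hconj, hadj⟩ := h.exists_distinct_projections
  have hinj : Function.Injective fun v => x v + √(p v * n v) := by
    intro u v huv
    by_contra hne
    exact hpos u v hne huv
  obtain ⟨q, slope, shift, hq, hslope, hline⟩ := exists_generic_projection (ι := ι)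
    (fun v => x v + √(p v * n v)) (fun v => x v - √(p v * n v)) hinj hconj
  have : Finite (Line V ι) := Finite.of_injective Line.idxFun (fun l m h => Line.ext h)
  obtain ⟨N, ⟨φ⟩⟩ := Finite.exists_equiv_fin E
  have hT : ∀ᶠ T : ℝ in atTop, ∀ t t' : E × V,
      slope t.1.1 ^ 2 * (p t.2 * n t.2) + slope t'.1.1 ^ 2 * (p t'.2 * n t'.2) <
        slope t.1.1 * slope t'.1.1 * (p t.2 * n t'.2) * T := by
    rw [eventually_all]
    intro t
    rw [eventually_all]
    intro t'
    have : 0 < slope t.1.1 * slope t'.1.1 * (p t.2 * n t'.2) :=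
      mul_pos (mul_pos (hslope _) (hslope _)) (mul_pos (hp _) (hn _))
    filter_upwards [eventually_gt_atTop ((slope t.1.1 ^ 2 * (p t.2 * n t.2) +
      slope t'.1.1 ^ 2 * (p t'.2 * n t'.2)) / (slope t.1.1 * slope t'.1.1 * (p t.2 * n t'.2)))]
      with T hT
    rw [div_lt_iff₀ this] at hT
    linarith
  obtain ⟨T, hT, hT1⟩ := (hT.and (eventually_ge_atTop 1)).exists
  have hT0 : 0 < T := by linarith
  let b : E → ℝ := fun l => T ^ (φ l : ℕ)
  have hb : ∀ l, 0 < b l := fun l => pow_pos hT0 _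
  let P : E × V → ℝ := fun t => slope t.1.1 * (b t.1 * p t.2)
  let M : E × V → ℝ := fun t => slope t.1.1 * ((b t.1)⁻¹ * n t.2)
  have hPM : ∀ t, P t * M t = slope t.1.1 ^ 2 * (p t.2 * n t.2) := by
    intro t
    have := (hb t.1).ne'
    simp only [P, M]
    field_simp
  have hPM0 : ∀ t t', 0 < P t * M t' := fun t t' =>
    mul_pos (mul_pos (hslope _) (mul_pos (hb _) (hp _)))
      (mul_pos (hslope _) (mul_pos (inv_pos.2 (hb _)) (hn _)))
  have hlt : ∀ t t', φ t'.1 < φ t.1 → P t * M t + P t' * M t' < P t * M t' := by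
    intro t t' hlt
    have h1 : T ≤ b t.1 * (b t'.1)⁻¹ := by
      rw [← div_eq_mul_inv, le_div_iff₀ (hb _), ← pow_succ']
      exact pow_le_pow_right₀ hT1 hlt
    have h2 : P t * M t' =
        slope t.1.1 * slope t'.1.1 * (p t.2 * n t'.2) * (b t.1 * (b t'.1)⁻¹) := by
      simp only [P, M]
      ring
    rw [hPM, hPM, h2]
    refine (hT t t').trans_le (mul_le_mul_of_nonneg_left h1 ?_)
    exact (mul_pos (mul_pos (hslope _) (hslope _)) (mul_pos (hp _) (hn _))).le
  have hneg : ∀ t t' : E × V, t.1 ≠ t'.1 → (P t - P t') * (M t - M t') < 0 := by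
    intro t t' hne
    have h1 := hPM0 t t'
    have h2 := hPM0 t' t
    rcases lt_or_gt_of_ne (fun h => hne (φ.injective h)) with h | h
    · have := hlt t' t h
      linarith
    · have := hlt t t' h
      linarith
  have hcross : ∀ z (l : E) v,
      (q z - (slope l.1 * x v + shift l.1)) ^ 2 = P (l, v) * M (l, v) ↔ z = l.1 v := by
    intro z l v
    have hs : P (l, v) * M (l, v) = (slope l.1 * √(p v * n v)) ^ 2 := by
      rw [hPM, mul_pow, Real.sq_sqrt (mul_pos (hp v) (hn v)).le]
    rw [hs, sq_eq_sq_iff_eq_or_eq_neg, ← hline l.1 v z]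
    constructor
    · rintro (h | h)
      · exact Or.inl (by linarith)
      · exact Or.inr (by linarith)
    · rintro (h | h)
      · exact Or.inl (by linarith)
      · exact Or.inr (by linarith)
  refine ⟨Sum.elim q (fun t => slope t.1.1 * x t.2 + shift t.1.1), Sum.elim (fun _ => 0) P,
    Sum.elim (fun _ => 0) M, ?_, ?_⟩
  · rintro (z | t) (z' | t') hx hy hz
    · exact congrArg _ (hq hx)
    · simp only [Sum.elim_inl, Sum.elim_inr] at hy
      have := hPM0 t' t'
      simp [← hy] at this
    · simp only [Sum.elim_inl, Sum.elim_inr] at hy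
      have := hPM0 t t
      simp [hy] at this
    · obtain ⟨l, v⟩ := t
      obtain ⟨l', v'⟩ := t'
      simp only [Sum.elim_inr] at hx hy hz
      by_cases hll : l = l'
      · subst hll
        have hs := (hslope l.1).ne'
        have hb' := (hb l).ne'
        have h1 : x v = x v' := mul_left_cancel₀ hs (by linarith)
        have h2 : p v = p v' := mul_left_cancel₀ hb' (mul_left_cancel₀ hs hy)
        have h3 : n v = n v' := mul_left_cancel₀ (inv_ne_zero hb') (mul_left_cancel₀ hs hz)
        have : v = v' := hinj (by simp only [h1, h2, h3])
        rw [this]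
      · have := hneg (l, v) (l', v') hll
        rw [hy, sub_self, zero_mul] at this
        exact absurd this (lt_irrefl _)
  · rintro (z | ⟨l, v⟩) (z' | ⟨l', v'⟩) hne
    · simp only [amalgam_adj_inl_inl, Sum.elim_inl, false_iff]
      intro h
      rw [sub_zero, zero_mul, sq_eq_zero_iff, sub_eq_zero] at h
      exact hne (congrArg _ (hq h))
    · simp only [amalgam_adj_inl_inr, Sum.elim_inl, Sum.elim_inr]
      rw [← hcross z l' v']
      constructor <;> intro h <;> linear_combination h
    · simp only [amalgam_adj_inr_inl, Sum.elim_inl, Sum.elim_inr]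
      rw [← hcross z' l v]
      constructor <;> intro h <;> linear_combination h
    · simp only [amalgam_adj_inr_inr, Sum.elim_inr]
      by_cases hll : l = l'
      · subst hll
        have hvv : v ≠ v' := fun h => hne (by rw [h])
        have e : (P (l, v) - P (l, v')) * (M (l, v) - M (l, v')) =
            slope l.1 ^ 2 * ((p v - p v') * (n v - n v')) := by
          have := (hb l).ne'
          simp only [P, M]
          field_simp
        rw [hadj v v' hvv, e, ← mul_right_inj' (pow_ne_zero 2 (hslope l.1).ne')]
        simp only [true_and]
        constructor <;> intro h <;> linear_combination h
      · simp only [hll, false_and, false_iff]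
        intro h
        have h1 := hneg (l, v) (l', v') hll
        rw [← h] at h1
        exact absurd h1 (not_lt.2 (sq_nonneg _))

/-- Adding a large constant to all radii leaves internal tangencies intact and makes external ones
impossible. -/
theorem RealizedByLightlike.realizedAtAngle {V : Type} [Finite V] {G : SimpleGraph V}
    (h : RealizedByLightlike V G) : RealizedAtAngle 1 V G := by
  obtain ⟨x, p, n, hinj, hadj⟩ := h
  have h0 : ∀ᶠ K : ℝ in atTop, ∀ v, 0 < (p v + n v) / 2 + K := by
    rw [eventually_all]
    intro v
    filter_upwards [eventually_gt_atTop (-((p v + n v) / 2))] with K hK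
    linarith
  have h1 : ∀ᶠ K : ℝ in atTop, ∀ u v,
      (x u - x v) ^ 2 + ((p u - n u) / 2 - (p v - n v) / 2) ^ 2 <
        ((p u + n u) / 2 + (p v + n v) / 2 + K * 2) ^ 2 := by
    rw [eventually_all]
    intro u
    rw [eventually_all]
    intro v
    exact eventually_lt_sq _ _ two_ne_zero
  obtain ⟨K, h0, h1⟩ := (h0.and h1).exists
  refine ⟨x, fun v => (p v - n v) / 2, fun v => (p v + n v) / 2 + K, h0, ?_, ?_⟩
  · intro u v hx hy hr
    exact hinj u v hx (by linarith) (by linarith)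
  · intro u v huv
    rw [hadj u v huv]
    have h2 := h1 u v
    constructor
    · intro h
      rw [h]
      ring
    · intro h
      rw [sq_eq_sq_iff_eq_or_eq_neg] at h
      rcases h with h | h
      · exfalso
        linarith
      · linear_combination h

/-- For every angle there are realizable graphs of arbitrarily large girth and chromatic number. -/
theorem exists_realizedAtAngle {c : ℝ} (hc0 : 0 ≤ c) (hc1 : c ≤ 1) (g n : ℕ) :
    ∃ (V : Type) (G : SimpleGraph V), Finite V ∧ RealizedAtAngle c V G ∧ G.IsLocallyForest g ∧
      ¬ G.Colorable n := by
  rcases hc1.lt_or_eq with hc1 | rfl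
  · exact exists_isLocallyForest_not_colorable (RealizedAtAngle c) (realizedAtAngle_unit c)
      (fun _ _ _ _ _ _ h => h.amalgam hc0 hc1) g n
  · obtain ⟨V, G, hV, hG, hg, hn⟩ := exists_isLocallyForest_not_colorable RealizedByLightlike
      realizedByLightlike_unit (fun _ _ _ _ _ _ h => h.amalgam) g n
    exact ⟨V, G, hV, hG.realizedAtAngle, hg, hn⟩

/-! ### The angle between circles in coordinates -/

/-- Rotation of a vector of the plane by a quarter turn. -/
def quarterTurn (a : Plane) : Plane := !₂[- a 1, a 0]

theorem inner_quarterTurn (a b : Plane) : inner ℝ (quarterTurn a) (quarterTurn b) = inner ℝ a b := by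
  simp [quarterTurn, PiLp.inner_apply, Fin.sum_univ_two]
  ring

theorem norm_quarterTurn (a : Plane) : ‖quarterTurn a‖ = ‖a‖ := by
  rw [@norm_eq_sqrt_real_inner, inner_quarterTurn, ← @norm_eq_sqrt_real_inner]

theorem angle_quarterTurn (a b : Plane) :
    InnerProductGeometry.angle (quarterTurn a) (quarterTurn b) = InnerProductGeometry.angle a b := by
  simp only [InnerProductGeometry.angle, inner_quarterTurn, norm_quarterTurn]

theorem quarterTurn_ne_zero {a : Plane} (ha : a ≠ 0) : quarterTurn a ≠ 0 := by
  rw [← norm_ne_zero_iff, norm_quarterTurn, norm_ne_zero_iff]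
  exact ha

theorem mem_orthogonal_singleton_iff {a u : Plane} (ha : a ≠ 0) :
    u ∈ (Submodule.span ℝ {a})ᗮ ↔ ∃ s : ℝ, u = s • quarterTurn a := by
  rw [Submodule.mem_orthogonal_singleton_iff_inner_right]
  constructor
  · intro h
    have h1 : a 0 * u 0 + a 1 * u 1 = 0 := by
      simp [PiLp.inner_apply, Fin.sum_univ_two] at h
      linarith
    have hD : a 0 ^ 2 + a 1 ^ 2 ≠ 0 := by
      intro h0
      apply ha
      ext i
      fin_cases i
      · simp
        nlinarith [sq_nonneg (a 0), sq_nonneg (a 1)]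
      · simp
        nlinarith [sq_nonneg (a 0), sq_nonneg (a 1)]
    refine ⟨(a 0 * u 1 - a 1 * u 0) / (a 0 ^ 2 + a 1 ^ 2), ?_⟩
    ext i
    fin_cases i
    · simp [quarterTurn]
      field_simp
      linear_combination a 0 * h1
    · simp [quarterTurn]
      field_simp
      linear_combination a 1 * h1
  · rintro ⟨s, rfl⟩
    simp [quarterTurn, PiLp.inner_apply, Fin.sum_univ_two]
    ring

theorem lineAngle_eq_min {l₁ l₂ : AffineSubspace ℝ Plane} {a b : Plane} (ha : a ≠ 0) (hb : b ≠ 0)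
    (h₁ : l₁.direction = (Submodule.span ℝ {a})ᗮ) (h₂ : l₂.direction = (Submodule.span ℝ {b})ᗮ) :
    lineAngle l₁ l₂ =
      min (InnerProductGeometry.angle a b) (Real.pi - InnerProductGeometry.angle a b) := by
  have hset : {α : ℝ | ∃ u ∈ l₁.direction, ∃ v ∈ l₂.direction,
      u ≠ 0 ∧ v ≠ 0 ∧ α = InnerProductGeometry.angle u v} =
      {InnerProductGeometry.angle a b, Real.pi - InnerProductGeometry.angle a b} := by
    ext α
    simp only [Set.mem_ofPred_eq, Set.mem_insert_iff, Set.mem_singleton_iff, h₁, h₂,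
      mem_orthogonal_singleton_iff ha, mem_orthogonal_singleton_iff hb]
    constructor
    · rintro ⟨_, ⟨s, rfl⟩, _, ⟨t, rfl⟩, hu, hv, rfl⟩
      have hs : s ≠ 0 := fun h => hu (by rw [h, zero_smul])
      have ht : t ≠ 0 := fun h => hv (by rw [h, zero_smul])
      rcases lt_or_gt_of_ne hs with hs | hs <;> rcases lt_or_gt_of_ne ht with ht | ht
      · left
        rw [InnerProductGeometry.angle_smul_left_of_neg _ _ hs,
          InnerProductGeometry.angle_smul_right_of_neg _ _ ht,
          InnerProductGeometry.angle_neg_neg, angle_quarterTurn]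
      · right
        rw [InnerProductGeometry.angle_smul_left_of_neg _ _ hs,
          InnerProductGeometry.angle_smul_right_of_pos _ _ ht,
          InnerProductGeometry.angle_neg_left, angle_quarterTurn]
      · right
        rw [InnerProductGeometry.angle_smul_left_of_pos _ _ hs,
          InnerProductGeometry.angle_smul_right_of_neg _ _ ht,
          InnerProductGeometry.angle_neg_right, angle_quarterTurn]
      · left
        rw [InnerProductGeometry.angle_smul_left_of_pos _ _ hs,
          InnerProductGeometry.angle_smul_right_of_pos _ _ ht, angle_quarterTurn]
    · rintro (rfl | rfl)
      · exact ⟨quarterTurn a, ⟨1, (one_smul _ _).symm⟩, quarterTurn b, ⟨1, (one_smul _ _).symm⟩,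
          quarterTurn_ne_zero ha, quarterTurn_ne_zero hb, (angle_quarterTurn a b).symm⟩
      · refine ⟨quarterTurn a, ⟨1, (one_smul _ _).symm⟩, -quarterTurn b, ⟨-1, by simp⟩,
          quarterTurn_ne_zero ha, neg_ne_zero.2 (quarterTurn_ne_zero hb), ?_⟩
        rw [InnerProductGeometry.angle_neg_right, angle_quarterTurn]
  rw [lineAngle, hset, csInf_pair]

theorem min_angle_eq_iff {θ α : ℝ} (hθ : θ ∈ Set.Icc 0 (Real.pi / 2)) (hα : α ∈ Set.Icc 0 Real.pi) :
    min α (Real.pi - α) = θ ↔ Real.cos α ^ 2 = Real.cos θ ^ 2 := by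
  obtain ⟨hθ0, hθ1⟩ := hθ
  have hπ := Real.pi_pos
  constructor
  · intro h
    rcases min_choice α (Real.pi - α) with h' | h'
    · rw [← h, h']
    · rw [← h, h', Real.cos_pi_sub, neg_sq]
  · intro h
    rcases sq_eq_sq_iff_eq_or_eq_neg.1 h with h | h
    · have : α = θ := Real.injOn_cos hα ⟨hθ0, by linarith⟩ h
      rw [this, min_eq_left (by linarith)]
    · rw [← Real.cos_pi_sub] at h
      have : α = Real.pi - θ := Real.injOn_cos hα ⟨by linarith, by linarith⟩ h
      rw [this, sub_sub_cancel, min_eq_right (by linarith)]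

/-- The circle with centre `(x, y)` and radius `r`. -/
def mkCircle (x y r : ℝ) (hr : 0 < r) : PlaneCircle := ⟨⟨!₂[x, y], r⟩, hr⟩

theorem mem_mkCircle {x y r : ℝ} {hr : 0 < r} {p : Plane} :
    p ∈ (mkCircle x y r hr).1 ↔ (p 0 - x) ^ 2 + (p 1 - y) ^ 2 = r ^ 2 := by
  change dist p !₂[x, y] = r ↔ _
  rw [← sq_eq_sq₀ dist_nonneg hr.le, EuclideanSpace.dist_eq, Real.sq_sqrt (by positivity)]
  simp [Fin.sum_univ_two, Real.dist_eq, sq_abs]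

theorem direction_tangentLine_mkCircle {x y r : ℝ} {hr : 0 < r} {p : Plane} :
    ((mkCircle x y r hr).tangentLine p).direction = (Submodule.span ℝ {p - !₂[x, y]})ᗮ :=
  EuclideanGeometry.Sphere.direction_orthRadius _ _

/-- The law of cosines at a common point of two circles. -/
theorem lineAngle_tangentLine_eq_iff {θ : ℝ} (hθ : θ ∈ Set.Icc 0 (Real.pi / 2))
    {x y r x' y' r' : ℝ} {hr : 0 < r} {hr' : 0 < r'} {p : Plane}
    (hp : p ∈ (mkCircle x y r hr).1) (hp' : p ∈ (mkCircle x' y' r' hr').1) :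
    lineAngle ((mkCircle x y r hr).tangentLine p) ((mkCircle x' y' r' hr').tangentLine p) = θ ↔
      ((x - x') ^ 2 + (y - y') ^ 2 - r ^ 2 - r' ^ 2) ^ 2 = (2 * Real.cos θ * r * r') ^ 2 := by
  have hn : ‖p - !₂[x, y]‖ = r := by
    rw [← dist_eq_norm]
    exact EuclideanGeometry.mem_sphere.1 hp
  have hn' : ‖p - !₂[x', y']‖ = r' := by
    rw [← dist_eq_norm]
    exact EuclideanGeometry.mem_sphere.1 hp'
  have h0 : p - !₂[x, y] ≠ 0 := by
    rw [← norm_ne_zero_iff, hn]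
    exact hr.ne'
  have h0' : p - !₂[x', y'] ≠ 0 := by
    rw [← norm_ne_zero_iff, hn']
    exact hr'.ne'
  have hin : 2 * inner ℝ (p - !₂[x, y]) (p - !₂[x', y']) =
      -((x - x') ^ 2 + (y - y') ^ 2 - r ^ 2 - r' ^ 2) := by
    rw [mem_mkCircle] at hp hp'
    rw [← hp, ← hp']
    simp [PiLp.inner_apply, Fin.sum_univ_two]
    ring
  rw [lineAngle_eq_min (a := p - !₂[x, y]) (b := p - !₂[x', y']) h0 h0'
    direction_tangentLine_mkCircle direction_tangentLine_mkCircle,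
    min_angle_eq_iff hθ ⟨InnerProductGeometry.angle_nonneg _ _, InnerProductGeometry.angle_le_pi _ _⟩,
    InnerProductGeometry.cos_angle, hn, hn']
  have h2 : (x - x') ^ 2 + (y - y') ^ 2 - r ^ 2 - r' ^ 2 =
    -(2 * inner ℝ (p - !₂[x, y]) (p - !₂[x', y'])) := by linarith
  rw [h2, div_pow, div_eq_iff (by positivity)]
  constructor <;> intro h
  · linear_combination 4 * h
  · linear_combination h / 4

theorem exists_common_point {c x y r x' y' r' : ℝ} (hr : 0 < r) (hr' : 0 < r') (hc : c ^ 2 ≤ 1)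
    (hne : ¬ (x = x' ∧ y = y' ∧ r = r'))
    (h : ((x - x') ^ 2 + (y - y') ^ 2 - r ^ 2 - r' ^ 2) ^ 2 = (2 * c * r * r') ^ 2) :
    ∃ p, p ∈ (mkCircle x y r hr).1 ∧ p ∈ (mkCircle x' y' r' hr').1 := by
  obtain ⟨D, hD⟩ : ∃ D, D = (x - x') ^ 2 + (y - y') ^ 2 := ⟨_, rfl⟩
  have hle : (D - r ^ 2 - r' ^ 2) ^ 2 ≤ 4 * r ^ 2 * r' ^ 2 := by
    rw [hD, h]
    nlinarith [mul_nonneg (sub_nonneg.2 hc) (sq_nonneg (r * r'))]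
  have hD0 : 0 < D := by
    have hDn : 0 ≤ D := hD ▸ by positivity
    rcases hDn.lt_or_eq with h0 | h0
    · exact h0
    exfalso
    have hx : (x - x') ^ 2 = 0 := by nlinarith [sq_nonneg (x - x'), sq_nonneg (y - y')]
    have hy : (y - y') ^ 2 = 0 := by nlinarith [sq_nonneg (x - x'), sq_nonneg (y - y')]
    rw [← h0] at hle
    have h1 : (r ^ 2 - r' ^ 2) ^ 2 = 0 := by
      apply le_antisymm _ (sq_nonneg _)
      linarith
    have h2 : r ^ 2 = r' ^ 2 := sub_eq_zero.1 (sq_eq_zero_iff.1 h1)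
    exact hne ⟨sub_eq_zero.1 (sq_eq_zero_iff.1 hx), sub_eq_zero.1 (sq_eq_zero_iff.1 hy),
      (sq_eq_sq₀ hr.le hr'.le).1 h2⟩
  -- coordinates along the line of centres and perpendicular to it, in units of `√D`
  obtain ⟨t, ht⟩ : ∃ t, t = (D + r ^ 2 - r' ^ 2) / (2 * D) := ⟨_, rfl⟩
  have ht' : 2 * D * t = D + r ^ 2 - r' ^ 2 := by
    rw [ht]
    field_simp
  obtain ⟨k, hk⟩ : ∃ k, k = √(r ^ 2 / D - t ^ 2) := ⟨_, rfl⟩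
  have hk2 : D * (t ^ 2 + k ^ 2) = r ^ 2 := by
    rw [hk, Real.sq_sqrt]
    · field_simp
      ring
    · rw [sub_nonneg, le_div_iff₀ hD0]
      have : 4 * D * (t ^ 2 * D) ≤ 4 * D * r ^ 2 := by
        have e : 4 * D * (t ^ 2 * D) = (D + r ^ 2 - r' ^ 2) ^ 2 := by
          rw [← ht']
          ring
        rw [e]
        linarith
      exact le_of_mul_le_mul_left this (by positivity)
  refine ⟨!₂[x + t * (x' - x) - k * (y' - y), y + t * (y' - y) + k * (x' - x)], ?_, ?_⟩
  · rw [mem_mkCircle, ← hk2, hD]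
    simp
    ring
  · rw [mem_mkCircle]
    have e : r' ^ 2 = D - 2 * D * t + D * (t ^ 2 + k ^ 2) := by
      rw [hk2, ht']
      ring
    rw [e, hD]
    simp
    ring

theorem intersectAtAngle_iff {θ : ℝ} (hθ : θ ∈ Set.Icc 0 (Real.pi / 2))
    {x y r x' y' r' : ℝ} (hr : 0 < r) (hr' : 0 < r') (hne : ¬ (x = x' ∧ y = y' ∧ r = r')) :
    IntersectAtAngle θ (mkCircle x y r hr) (mkCircle x' y' r' hr') ↔
      ((x - x') ^ 2 + (y - y') ^ 2 - r ^ 2 - r' ^ 2) ^ 2 = (2 * Real.cos θ * r * r') ^ 2 := by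
  constructor
  · rintro ⟨⟨p, hp, hp'⟩, h⟩
    exact (lineAngle_tangentLine_eq_iff hθ hp hp').1 (h p hp hp')
  · intro h
    exact ⟨exists_common_point hr hr' (Real.cos_sq_le_one θ) hne h,
      fun p hp hp' => (lineAngle_tangentLine_eq_iff hθ hp hp').2 h⟩

theorem mkCircle_inj {x y r x' y' r' : ℝ} {hr : 0 < r} {hr' : 0 < r'}
    (h : mkCircle x y r hr = mkCircle x' y' r' hr') : x = x' ∧ y = y' ∧ r = r' := by
  have h1 := congrArg (fun C : PlaneCircle => C.1.center 0) h
  have h2 := congrArg (fun C : PlaneCircle => C.1.center 1) h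
  have h3 := congrArg (fun C : PlaneCircle => C.1.radius) h
  exact ⟨by simpa [mkCircle] using h1, by simpa [mkCircle] using h2, h3⟩

theorem RealizedAtAngle.exists_iso {θ : ℝ} (hθ : θ ∈ Set.Icc 0 (Real.pi / 2)) {V : Type} [Finite V]
    {G : SimpleGraph V} (h : RealizedAtAngle (Real.cos θ) V G) :
    ∃ 𝒞 : Set PlaneCircle, 𝒞.Finite ∧ Nonempty (G ≃g thetaGraph θ 𝒞) := by
  obtain ⟨x, y, r, hr, hinj, hadj⟩ := h
  let f : V → PlaneCircle := fun v => mkCircle (x v) (y v) (r v) (hr v)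
  have hf : f.Injective := by
    intro u v huv
    obtain ⟨h1, h2, h3⟩ := mkCircle_inj huv
    exact hinj u v h1 h2 h3
  refine ⟨Set.range f, Set.finite_range f, ⟨Equiv.ofInjective f hf, ?_⟩⟩
  intro u v
  by_cases huv : u = v
  · subst huv
    simp
  · rw [hadj u v huv, ← intersectAtAngle_iff hθ (hr u) (hr v)
      (fun h => huv (hinj u v h.1 h.2.1 h.2.2))]
    exact ⟨fun h => h.2, fun h => ⟨fun he => huv ((Equiv.ofInjective f hf).injective he), h⟩⟩

theorem theorem2 (θ : ℝ) (hθ : θ ∈ Set.Icc 0 (Real.pi / 2)) (g k : ℕ) :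
    ∃ 𝒞 : Set PlaneCircle, 𝒞.Finite ∧
      (g : ℕ∞) ≤ (thetaGraph θ 𝒞).egirth ∧ (k : ℕ∞) ≤ (thetaGraph θ 𝒞).chromaticNumber := by
  have hc : 0 ≤ Real.cos θ := Real.cos_nonneg_of_mem_Icc ⟨by linarith [hθ.1, Real.pi_pos], hθ.2⟩
  obtain ⟨V, G, _, hG, hg, hk⟩ := exists_realizedAtAngle hc (Real.cos_le_one θ) g k
  obtain ⟨𝒞, h𝒞, ⟨φ⟩⟩ := hG.exists_iso hθ
  refine ⟨𝒞, h𝒞, ?_, ?_⟩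
  · rw [← φ.egirth_eq]
    exact hg.le_egirth
  · rw [SimpleGraph.le_chromaticNumber_iff_colorable]
    intro m hm
    have hm' : G.Colorable m := hm.of_hom φ.toHom
    by_contra! hlt
    exact hk (hm'.mono (by exact_mod_cast hlt.le))
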